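/- Let $N\ge 1$, $\alpha\in\mathbb{Z}/N\mathbb{Z}$ (in a power, $\alpha$ stands for its representative in $\{0,\dots,N-1\}$), $r\ge 0$, let $\eta_1,\dots,\eta_r\in\mathbb{C}$ be $N$-th roots of unity, put $\eta_{r+1}:=1$, and let $k_1,\dots,k_r$ be positive integers. For complex numbers $a_1,\dots,a_m\in\{0\}\cup\mu_N$ let $I(a_1,\dots,a_m)$ be the regularized iterated integral, i.e. the constant term $P(0)$ of the unique polynomial $P$ with $$\int_{z<t_1<\cdots<t_m<1-z}\prod_{i=1}^m\frac{dt_i}{t_i-a_i}=P(\log z)+o(1)\qquad(z\to+0),$$ and, for $\xi_1,\dots,\xi_s\in\mu_N$ and positive integers $l_1,\dots,l_s$, let $$L^{\mathrm{sh}}\binom{\xi_1,\dots,\xi_s}{l_1,\dots,l_s}:=(-1)^sI\bigl(\xi_1^{-1},\{0\}^{l_1-1},\dots,\xi_s^{-1},\{0\}^{l_s-1}\bigr)$$ be the shuffle-regularized multiple $L$-value (equal to $1$ for $s=0$). Put $$L^{\mathrm{sh}}_{\widehat{\mathcal S},\alpha}\binom{\boldsymbol\eta}{\mathbf k}:=\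sum_{i=0}^r(-1)^{k_{i+1}+\cdots+k_r}\eta_{i+1}^{\alpha}\,L^{\mathrm{sh}}\binom{\eta_1/\eta_{i+1},\dots,\eta_i/\eta_{i+1}}{k_1,\dots,k_i}\sum_{f_{i+1},\dots,f_r\ge0}\Bigl(\prod_{j=i+1}^r\binom{k_j+f_j-1}{f_j}\Bigr)L^{\mathrm{sh}}\binom{1/\eta_{i+1},\eta_r/\eta_{i+1},\dots,\eta_{i+2}/\eta_{i+1}}{k_r+f_r,\dots,k_{i+1}+f_{i+1}}t^{f_{i+1}+\cdots+f_r}\in\mathbb{C}[[t]].$$ The $t$-adic symmetric multiple polylogarithm at $\boldsymbol\eta$ is the same expression with each $L^{\mathrm{sh}}$ replaced by the series $\mathrm{Li}\binom{x_1,\dots,x_s}{l_1,\dots,l_s}=\sum_{0<n_1<\cdots<n_s}\frac{x_1^{n_1}x_2^{n_2-n_1}\cdots x_s^{n_s-n_{s-1}}}{n_1^{l_1}\cdots n_s^{l_s}}$, summed as follows. For $M\ge1$, let $\text{\pounds}_{\widehat{\mathcal S},\alpha,<M}\binom{\boldsymbol\eta}{\mathbf k}\in\mathbb{C}[[t]]$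 be the partial sum in which, in the $i$-th summand, only those terms are kept for which $n_i+m_{i+1}<M$; here $0<n_1<\cdots<n_i$ and $0<m_r<\cdots<m_{i+1}$ are the summation variables of the first and the second series, and $n_0=m_{r+1}=0$. The value $\text{\pounds}_{\widehat{\mathcal S},\alpha}\binom{\boldsymbol\eta}{\mathbf k}$ is the coefficientwise limit for $M\to\infty$. For a subfield $K\subseteq\mathbb{C}$ let $\mathcal{Z}_N^K$ be the $K$-linear span of all $L^{\mathrm{sh}}\binom{\boldsymbol\xi}{\mathbf l}$ with $s\ge0$, $\boldsymbol\xi\in\mu_N^s$, $\mathbf l\in\mathbb{Z}_{\ge1}^s$. If $K$ contains $\eta_1^\alpha,\dots,\eta_r^\alpha$ (e.g. $K=\mathbb{Q}$ if $\alpha=0$, and $K=\mathbb{Q}(\mu_N)$ in general), the $t$-adic symmetric multiple $L$-value $L_{\widehat{\mathcal S},\alpha}\binom{\boldsymbol\eta}{\mathbf k}$ is the class of $L^{\mathrm{sh}}_{\widehat{\mathcal S},\alpha}\binom{\boldsymbol\eta}{\mathbf k}$ in $(\mathcal{Z}_N^K/\pi^2\mathcal{Z}_N^K)[[t]]$. **Lemma.**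 For every $n\ge0$ the coefficient of $t^n$ in $\text{\pounds}_{\widehat{\mathcal S},\alpha,<M}\binom{\boldsymbol\eta}{\mathbf k}$ converges as $M\to\infty$. The limit $\text{\pounds}_{\widehat{\mathcal S},\alpha}\binom{\boldsymbol\eta}{\mathbf k}\in\mathbb{C}[[t]]$ equals $L^{\mathrm{sh}}_{\widehat{\mathcal S},\alpha}\binom{\boldsymbol\eta}{\mathbf k}$. For every subfield $K$ as above, its coefficients lie in $\mathcal{Z}_N^K$, and its class in $(\mathcal{Z}_N^K/\pi^2\mathcal{Z}_N^K)[[t]]$ is $L_{\widehat{\mathcal S},\alpha}\binom{\boldsymbol\eta}{\mathbf k}$. -/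

import Mathlib

open Filter Topology
open scoped Classical

noncomputable section

namespace TAdicSymmetric

/-! ### Regularized iterated integrals along the straight path from `0` to `1` -/

/-- The iterated integral `∫_{p < t₁ < ⋯ < t_m < q} ∏ dt_i / (t_i - a_i)`, where the letters are
listed in the order `[a_m, …, a₁]`: the head of the list belongs to the largest variable. -/
def iterIntRev : List ℂ → ℝ → ℝ → ℂ
  | [], _, _ => 1
  | a :: w, p, q => ∫ t in p..q, iterIntRev w p t / ((t : ℂ) - a)

/-- The iterated integral `∫_{p < t₁ < ⋯ < t_m < q} ∏ dt_i / (t_i - a_i)` of `w = [a₁, …, a_m]`. -/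
def iterInt (w : List ℂ) (p q : ℝ) : ℂ := iterIntRev w.reverse p q

/-- `P` is the part of order `z ^ 0` in the asymptotic expansion in powers of `z` and `log z`
of the integral over `z < t₁ < ⋯ < t_m < 1 - z`, as `z → +0`. Such a `P` is unique. -/
def IsLogExpansion (w : List ℂ) (P : Polynomial ℂ) : Prop :=
  Tendsto (fun z : ℝ => iterInt w z (1 - z) - P.eval ((Real.log z : ℝ) : ℂ)) (𝓝[>] 0) (𝓝 0)

/-- The regularized iterated integral `I_dch(0; e_{a₁} ⋯ e_{a_m}; 1)` between the tangential base
points `(0, 1)` and `(1, -1)`: the coefficient of `(log z)^0 z^0` in the asymptotic expansion. -/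
def regInt (w : List ℂ) : ℂ :=
  if h : ∃ P : Polynomial ℂ, IsLogExpansion w P then h.choose.coeff 0 else 0

/-- The word `e_{1/x₁} e₀^{k₁-1} ⋯ e_{1/x_r} e₀^{k_r-1}`. -/
def word {r : ℕ} (x : Fin r → ℂ) (k : Fin r → ℕ) : List ℂ :=
  (List.ofFn fun j => (x j)⁻¹ :: List.replicate (k j - 1) 0).flatten

/-- The shuffle-regularized multiple `L`-value. -/
def Lsh {r : ℕ} (x : Fin r → ℂ) (k : Fin r → ℕ) : ℂ :=
  (-1) ^ r * regInt (word x k)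

/-! ### The terms of the multiple polylogarithm series -/

/-- The predecessor `n_{j-1}` of the entry `n_j`, with `n_0 = 0` before the first entry. -/
def prevEntry {r : ℕ} (n : Fin r → ℕ) (j : Fin r) : ℕ :=
  if 0 < j.val then n ⟨j.val - 1, by omega⟩ else 0

/-- `x₁^{n₁} x₂^{n₂-n₁} ⋯ x_r^{n_r-n_{r-1}} / (n₁^{k₁} ⋯ n_r^{k_r})`. -/
def liTerm {r : ℕ} (x : Fin r → ℂ) (k n : Fin r → ℕ) : ℂ :=
  ∏ j, x j ^ (n j - prevEntry n j) / (n j : ℂ) ^ k j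

/-- The tuples `0 < n₁ < ⋯ < n_r < M`. -/
def incTuples (r M : ℕ) : Finset (Fin r → ℕ) :=
  (Fintype.piFinset fun _ => Finset.Ico 1 M).filter StrictMono

/-- The largest entry `n_r` of an increasing tuple (`0` for the empty tuple). -/
def top {r : ℕ} (n : Fin r → ℕ) : ℕ := Finset.univ.sup n

/-- The partial sum of the product of two series `Li(x; k) · Li(y; l)` over all pairs of tuples
`0 < n₁ < ⋯ < n_a`, `0 < m₁ < ⋯ < m_b` with `n_a + m_b < M`. -/
def liProdTrunc {a b : ℕ} (M : ℕ) (x : Fin a → ℂ) (k : Fin a → ℕ)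
    (y : Fin b → ℂ) (l : Fin b → ℕ) : ℂ :=
  ∑ p ∈ (incTuples a M ×ˢ incTuples b M).filter (fun p => top p.1 + top p.2 < M),
    liTerm x k p.1 * liTerm y l p.2

/-! ### The symmetric construction

Entries are numbered from `0`, so `x_{i+1}` of the usual notation is `extend x i`; moreover
`x_{r+1} = 1`. -/

/-- `x` continued by `1`. -/
def extend {r : ℕ} (x : Fin r → ℂ) (j : ℕ) : ℂ := if h : j < r then x ⟨j, h⟩ else 1

/-- `(x₁/x_{i+1}, …, x_i/x_{i+1})`. -/
def leftArg {r : ℕ} (x : Fin r → ℂ) (i : Fin (r + 1)) : Fin i.val → ℂ :=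
  fun j => x ⟨j.val, by omega⟩ / extend x i

/-- `(k₁, …, k_i)`. -/
def leftIdx {r : ℕ} (k : Fin r → ℕ) (i : Fin (r + 1)) : Fin i.val → ℕ :=
  fun j => k ⟨j.val, by omega⟩

/-- `(1/x_{i+1}, x_r/x_{i+1}, …, x_{i+2}/x_{i+1})`. -/
def rightArg {r : ℕ} (x : Fin r → ℂ) (i : Fin (r + 1)) : Fin (r - i.val) → ℂ :=
  fun j => extend x (r - j.val) / extend x i

/-- `(k_r, …, k_{i+1})`. -/
def rightIdx {r : ℕ} (k : Fin r → ℕ) (i : Fin (r + 1)) : Fin (r - i.val) → ℕ :=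
  fun j => k ⟨r - 1 - j.val, by omega⟩

/-- The partial sum, up to `M`, of the `t`-adic symmetric multiple polylogarithm at `x`, as a power
series in `t`: in the `i`-th summand only the terms with `n_i + m_{i+1} < M` are kept, where
`0 < n₁ < ⋯ < n_i` and `0 < m_r < ⋯ < m_{i+1}` are the summation variables of its two factors. -/
def polylogTrunc {r : ℕ} (a : ℕ) (x : Fin r → ℂ) (k : Fin r → ℕ) (M : ℕ) : PowerSeries ℂ :=
  PowerSeries.mk fun d => ∑ i : Fin (r + 1),
    (-1) ^ (∑ j, rightIdx k i j) * extend x i ^ a *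
      ∑ f ∈ Finset.piAntidiag (Finset.univ : Finset (Fin (r - i.val))) d,
        ((∏ j, (rightIdx k i j + f j - 1).choose (f j) : ℕ) : ℂ) *
          liProdTrunc M (leftArg x i) (leftIdx k i) (rightArg x i) (rightIdx k i + f)

/-- The power series in `t` built from shuffle-regularized multiple `L`-values whose class is
the `t`-adic symmetric multiple `L`-value. -/
def LSymSh {r : ℕ} (a : ℕ) (x : Fin r → ℂ) (k : Fin r → ℕ) : PowerSeries ℂ :=
  PowerSeries.mk fun d => ∑ i : Fin (r + 1),
    (-1) ^ (∑ j, rightIdx k i j) * extend x i ^ a *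
      (Lsh (leftArg x i) (leftIdx k i) *
        ∑ f ∈ Finset.piAntidiag (Finset.univ : Finset (Fin (r - i.val))) d,
          ((∏ j, (rightIdx k i j + f j - 1).choose (f j) : ℕ) : ℂ) *
            Lsh (rightArg x i) (rightIdx k i + f))

/-! ### The space of multiple `L`-values and the quotient by `π²` -/

/-- The `K`-span of the multiple `L`-values of level `N` (the empty index gives `1`). -/
def LSpace (K : Subfield ℂ) (N : ℕ) : Submodule K ℂ :=
  Submodule.span K {c | ∃ (s : ℕ) (ξ : Fin s → ℂ) (l : Fin s → ℕ),
    (∀ j, ξ j ^ N = 1) ∧ (∀ j, 1 ≤ l j) ∧ c = Lsh ξ l}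

/-- `π²` times the span of the multiple `L`-values. -/
def piSqLSpace (K : Subfield ℂ) (N : ℕ) : Submodule K ℂ :=
  (LSpace K N).map (LinearMap.mulLeft K ((Real.pi : ℂ) ^ 2))

/-- The `t`-adic symmetric multiple `L`-value, as its sequence of coefficients modulo
`π² · LSpace K N`. The quotient of `LSpace K N` sits inside `ℂ ⧸ piSqLSpace K N`. -/
def LSym {r : ℕ} (K : Subfield ℂ) (N : ℕ) (α : ZMod N) (η : Fin r → ℂ) (k : Fin r → ℕ) :
    ℕ → ℂ ⧸ piSqLSpace K N :=
  fun d => (piSqLSpace K N).mkQ (PowerSeries.coeff d (LSymSh α.val η k))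

end TAdicSymmetric

end

/-! Words are written with the letter of the largest variable at the head. The iterated integral of
an admissible word from 0 is a power series, and its coefficients `liCoeff` are, up to sign, the
sums of the terms of Li over tuples with prescribed largest entry. The condition n_i + m_{i+1} < M
therefore truncates the product of two such series by total degree (`liProdTrunc_eq`). Both the
series (`liSeries_mul`) and the regularized values (`regIntRev_mul`) multiply by the shuffle
product. Hence a truncated product minus the product of the two L-values is, up to sign, the shuffle
sum of the one-word errors `truncError M` (`liProdTrunc_sub`).

If the head of a word is not 1, its series converges at 1, and by Abel's theorem the sum is the
regularized value (`tendsto_sum_liCoeff`), so its error tends to 0. Words with head 1 may diverge.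
Their errors form a functional `onHead 1 ψ`, and deleting a leading letter is a derivation for the
shuffle product (`shuffleSum_onHead`), so the 1 is deleted from the left word or from the right
word. Deletion from the left word of summand i requires η_i = η_{i+1} and k_i = 1. Deletion from the
right word of summand i-1 requires the same, together with f_i = 0. The remaining pairs of words
coincide, while (-1)^{k_i} = -1 makes the coefficients opposite. Thus the divergent parts cancel
exactly for each M, before any limit (`sum_symCoeff_onHead`).

Regularized values are controlled by expansions P(log s) + O(√s) at 1 - s, a form preserved by
integration and precise enough for products. The shuffle product also puts products of L-values back
into their span, which gives the statement on coefficients. -/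

noncomputable section

namespace TAdicSymmetric

/-! ### Shuffles of words -/

/-- The list of all shuffles of two words. -/
def shuffles {A : Type*} : List A → List A → List (List A)
  | [], v => [v]
  | a :: u, [] => [a :: u]
  | a :: u, b :: v =>
    (shuffles u (b :: v)).map (a :: ·) ++ (shuffles (a :: u) v).map (b :: ·)
termination_by u v => u.length + v.length

theorem shuffles_nil_left {A : Type*} (v : List A) : shuffles [] v = [v] := by
  rw [shuffles]

theorem shuffles_nil_right {A : Type*} (u : List A) : shuffles u [] = [u] := by
  cases u <;> rw [shuffles]

theorem shuffles_cons_cons {A : Type*} (a b : A) (u v : List A) :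
    shuffles (a :: u) (b :: v) =
      (shuffles u (b :: v)).map (a :: ·) ++ (shuffles (a :: u) v).map (b :: ·) := by
  rw [shuffles]

/-- The sum of the values of a function on words over all shuffles of two words. -/
def shuffleSum {A E : Type*} [AddCommMonoid E] (φ : List A → E) (u v : List A) : E :=
  ((shuffles u v).map φ).sum

section shuffleSum

variable {A E : Type*} [AddCommMonoid E]

theorem shuffleSum_nil_left (φ : List A → E) (v : List A) : shuffleSum φ [] v = φ v := by
  simp [shuffleSum, shuffles_nil_left]

theorem shuffleSum_nil_right (φ : List A → E) (u : List A) : shuffleSum φ u [] = φ u := by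
  simp [shuffleSum, shuffles_nil_right]

theorem shuffleSum_cons_cons (φ : List A → E) (a b : A) (u v : List A) :
    shuffleSum φ (a :: u) (b :: v) =
      shuffleSum (fun w => φ (a :: w)) u (b :: v) +
        shuffleSum (fun w => φ (b :: w)) (a :: u) v := by
  simp [shuffleSum, shuffles_cons_cons, Function.comp_def]

theorem map_shuffleSum {F : Type*} [AddCommMonoid F] (g : E →+ F) (φ : List A → E)
    (u v : List A) : g (shuffleSum φ u v) = shuffleSum (fun w => g (φ w)) u v := by
  simp [shuffleSum, map_list_sum, Function.comp_def]

theorem shuffleSum_congr {φ ψ : List A → E} {u v : List A}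
    (h : ∀ w ∈ shuffles u v, φ w = ψ w) : shuffleSum φ u v = shuffleSum ψ u v := by
  rw [shuffleSum, shuffleSum, List.map_congr_left h]

theorem shuffleSum_zero (u v : List A) : shuffleSum (fun _ => (0 : E)) u v = 0 := by
  simp [shuffleSum]

theorem shuffleSum_add (φ ψ : List A → E) (u v : List A) :
    shuffleSum (fun w => φ w + ψ w) u v = shuffleSum φ u v + shuffleSum ψ u v := by
  simp [shuffleSum, List.sum_map_add]

/-- `ψ` evaluated at the tail of a word with head `a`, and `0` at all other words. -/
def onHead (a : A) (ψ : List A → E) : List A → E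
  | [] => 0
  | b :: w => if b = a then ψ w else 0

/-- Removal of a leading letter is a derivation for the shuffle product. -/
theorem shuffleSum_onHead (a : A) (ψ : List A → E) (u v : List A) :
    shuffleSum (onHead a ψ) u v =
      onHead a (fun w => shuffleSum ψ w v) u + onHead a (fun w => shuffleSum ψ u w) v := by
  have key : ∀ (b : A) (u v : List A), shuffleSum (fun w => onHead a ψ (b :: w)) u v =
      if b = a then shuffleSum ψ u v else 0 := by
    intro b u v
    by_cases hb : b = a
    · simp [onHead, hb]
    · simp [onHead, hb, shuffleSum_zero]
  cases u with
  | nil =>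
    rw [shuffleSum_nil_left]
    cases v <;> simp [onHead, shuffleSum_nil_left]
  | cons b u =>
    cases v with
    | nil => simp [onHead, shuffleSum_nil_right]
    | cons c v =>
      rw [shuffleSum_cons_cons, key, key]
      rfl

theorem length_of_mem_shuffles {u v w : List A} (h : w ∈ shuffles u v) :
    w.length = u.length + v.length := by
  induction u, v using shuffles.induct generalizing w with
  | case1 v => simp_all [shuffles_nil_left]
  | case2 a u => simp_all [shuffles_nil_right]
  | case3 a u b v ih₁ ih₂ =>
    simp only [shuffles_cons_cons, List.mem_append, List.mem_map] at h
    rcases h with ⟨w, hw, rfl⟩ | ⟨w, hw, rfl⟩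
    · have := ih₁ hw
      simp only [List.length_cons] at *
      omega
    · have := ih₂ hw
      simp only [List.length_cons] at *
      omega

end shuffleSum

/-! ### Admissible words

Words are written with the letter of the largest variable first, as in `iterIntRev`. -/

/-- The words in the letters `0` and `μ_N` whose last entry (the letter of the smallest variable)
is not `0`. -/
def Admissible (N : ℕ) : List ℂ → Prop
  | [] => True
  | a :: w => (a = 0 ∨ a ^ N = 1) ∧ (w = [] → a ≠ 0) ∧ Admissible N w

/-- The last letter of a shuffle is the last letter of one of the factors. -/
theorem Admissible.of_mem_shuffles {N : ℕ} {u v w : List ℂ} (hu : Admissible N u)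
    (hv : Admissible N v) (h : w ∈ shuffles u v) : Admissible N w := by
  induction u, v using shuffles.induct generalizing w with
  | case1 v => simp_all [shuffles_nil_left]
  | case2 a u => simp_all [shuffles_nil_right]
  | case3 a u b v ih₁ ih₂ =>
    simp only [shuffles_cons_cons, List.mem_append, List.mem_map] at h
    rcases h with ⟨w, hw, rfl⟩ | ⟨w, hw, rfl⟩
    · refine ⟨hu.1, fun h => ?_, ih₁ hu.2.2 hv hw⟩
      have := length_of_mem_shuffles hw
      simp [h] at this
    · refine ⟨hv.1, fun h => ?_, ih₂ hu hv.2.2 hw⟩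
      have := length_of_mem_shuffles hw
      simp only [h, List.length_nil, List.length_cons] at this
      omega

theorem norm_letter {N : ℕ} (hN : N ≠ 0) {a : ℂ} (ha : a = 0 ∨ a ^ N = 1) (h0 : a ≠ 0) :
    ‖a‖ = 1 :=
  Complex.norm_eq_one_of_pow_eq_one (ha.resolve_left h0) hN

/-! ### Taylor coefficients of iterated integrals -/

/-- The Taylor coefficients at `0` of `q ↦ iterIntRev w 0 q`. -/
def liCoeff : List ℂ → ℕ → ℂ
  | [], n => if n = 0 then 1 else 0
  | a :: w, n =>
    if a = 0 then liCoeff w n / n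
    else -(∑ m ∈ Finset.range n, liCoeff w m * a⁻¹ ^ (n - m)) / n

/-- Both branches of `liCoeff` divide by n, and division by 0 gives 0, as befits an integral from 0
to 0. -/
theorem liCoeff_cons_zero (a : ℂ) (w : List ℂ) : liCoeff (a :: w) 0 = 0 := by
  simp [liCoeff]

/-- The differential equation (q - a) F' = G of iterated integration, read off coefficientwise; it
treats a = 0 and a ≠ 0 alike. -/
theorem liCoeff_recurrence {N : ℕ} {a : ℂ} {w : List ℂ} (h : Admissible N (a :: w)) (n : ℕ) :
    n * liCoeff (a :: w) n - a * ((n + 1 : ℕ) * liCoeff (a :: w) (n + 1)) = liCoeff w n := by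
  by_cases ha : a = 0
  · subst ha
    rcases Nat.eq_zero_or_pos n with rfl | hn
    · have hw : w ≠ [] := fun hw => h.2.1 hw rfl
      obtain ⟨b, w, rfl⟩ := List.exists_cons_of_ne_nil hw
      simp [liCoeff_cons_zero]
    · have : (n : ℂ) ≠ 0 := by exact_mod_cast hn.ne'
      simp only [liCoeff, if_true]
      field_simp
      simp
  · have h1 : ∀ m : ℕ, (m : ℂ) * liCoeff (a :: w) m =
        -(∑ i ∈ Finset.range m, liCoeff w i * a⁻¹ ^ (m - i)) := by
      intro m
      rcases Nat.eq_zero_or_pos m with rfl | hm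
      · simp
      · have : (m : ℂ) ≠ 0 := by exact_mod_cast hm.ne'
        simp only [liCoeff, if_neg ha]
        field_simp
    have h2 : ∑ i ∈ Finset.range n, liCoeff w i * a⁻¹ ^ (n + 1 - i) =
        a⁻¹ * ∑ i ∈ Finset.range n, liCoeff w i * a⁻¹ ^ (n - i) := by
      rw [Finset.mul_sum]
      refine Finset.sum_congr rfl fun i hi => ?_
      rw [Nat.sub_add_comm (Finset.mem_range.1 hi).le, pow_succ]
      ring
    rw [h1, h1, Finset.sum_range_succ, h2]
    simp only [Nat.add_sub_cancel_left, pow_one]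
    field_simp
    ring

/-- The Taylor series at `0` of `q ↦ iterIntRev w 0 q`. -/
def liSeries (w : List ℂ) : PowerSeries ℂ := PowerSeries.mk (liCoeff w)

theorem liSeries_nil : liSeries [] = 1 := by
  ext n
  simp [liSeries, liCoeff, PowerSeries.coeff_one]

open PowerSeries in
theorem liSeries_derivative {N : ℕ} {a : ℂ} {w : List ℂ} (h : Admissible N (a :: w)) :
    (X - C a) * derivative ℂ (liSeries (a :: w)) = liSeries w := by
  ext n
  rw [sub_mul, map_sub, coeff_C_mul, coeff_derivative]
  have : coeff n (X * derivative ℂ (liSeries (a :: w))) = n * liCoeff (a :: w) n := by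
    cases n with
    | zero => simp
    | succ n =>
      rw [coeff_succ_X_mul, coeff_derivative]
      simp [liSeries, mul_comm]
  have hr := liCoeff_recurrence h n
  push_cast at hr
  rw [this]
  simp only [liSeries, coeff_mk]
  rw [← hr]
  ring

-- Leibniz rule: by induction both sides have the same derivative after multiplication by (X - a)(X
-- - b), and both constant terms vanish.
open PowerSeries in
theorem liSeries_mul {N : ℕ} {u v : List ℂ} (hu : Admissible N u) (hv : Admissible N v) :
    liSeries u * liSeries v = shuffleSum liSeries u v := by
  induction u, v using shuffles.induct with
  | case1 v => rw [shuffleSum_nil_left, liSeries_nil, one_mul]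
  | case2 a u => rw [shuffleSum_nil_right, liSeries_nil, mul_one]
  | case3 a u b v ih₁ ih₂ =>
    have hne : ∀ c : ℂ, (X - C c : PowerSeries ℂ) ≠ 0 := fun c h => by
      have := congrArg (coeff 1) h
      simp at this
    have hadd : ∀ (c : ℂ) (u v : List ℂ),
        (∀ w ∈ shuffles u v, Admissible N (c :: w)) →
        (X - C c) * derivative ℂ (shuffleSum (fun w => liSeries (c :: w)) u v) =
          shuffleSum liSeries u v := by
      intro c u v h
      rw [show (X - C c) * derivative ℂ (shuffleSum (fun w => liSeries (c :: w)) u v) =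
        ((AddMonoidHom.mulLeft (X - C c)).comp (derivative ℂ).toLinearMap.toAddMonoidHom)
          (shuffleSum (fun w => liSeries (c :: w)) u v) from rfl, map_shuffleSum]
      exact shuffleSum_congr fun w hw => liSeries_derivative (h w hw)
    have key := fun w hw => Admissible.of_mem_shuffles (w := w) hu hv hw
    simp only [shuffles_cons_cons, List.mem_append, List.mem_map] at key
    refine derivative.ext ?_ ?_
    -- X - a is not invertible when a = 0, so it is cancelled as a nonzero element of a domain.
    · refine mul_left_cancel₀ (mul_ne_zero (hne a) (hne b)) ?_
      rw [shuffleSum_cons_cons, map_add, mul_add, Derivation.leibniz, smul_eq_mul, smul_eq_mul]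
      have e₁ := hadd a u (b :: v) fun w hw => key _ (Or.inl ⟨w, hw, rfl⟩)
      have e₂ := hadd b (a :: u) v fun w hw => key _ (Or.inr ⟨w, hw, rfl⟩)
      rw [← ih₁ hu.2.2 hv] at e₁
      rw [← ih₂ hu hv.2.2] at e₂
      have d₁ := liSeries_derivative hu
      have d₂ := liSeries_derivative hv
      linear_combination (X - C a) * liSeries (a :: u) * d₂ + (X - C b) * liSeries (b :: v) * d₁
        - (X - C b) * e₁ - (X - C a) * e₂
    · have h0 : ∀ (c : ℂ) (u v : List ℂ),
          constantCoeff (shuffleSum (fun w => liSeries (c :: w)) u v) = 0 := by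
        intro c u v
        rw [show constantCoeff (shuffleSum (fun w => liSeries (c :: w)) u v) =
          (constantCoeff (R := ℂ)).toAddMonoidHom
            (shuffleSum (fun w => liSeries (c :: w)) u v) from rfl, map_shuffleSum]
        rw [← shuffleSum_zero u v]
        exact shuffleSum_congr fun w _ => by simp [liSeries, liCoeff_cons_zero]
      rw [shuffleSum_cons_cons, map_add, h0, h0, map_mul]
      simp [liSeries, liCoeff_cons_zero]


/-! ### Growth of the Taylor coefficients -/

theorem sum_inv_sqrt_le (n : ℕ) :
    ∑ m ∈ Finset.range n, 1 / √((m : ℝ) + 1) ≤ 2 * √(n : ℝ) := by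
  induction n with
  | zero => simp
  | succ n ih =>
    rw [Finset.sum_range_succ]
    push_cast
    have h1 : 0 < √((n : ℝ) + 1) := Real.sqrt_pos.2 (by positivity)
    have h2 : √((n : ℝ) + 1) ^ 2 = n + 1 := Real.sq_sqrt (by positivity)
    have h3 : √(n : ℝ) ^ 2 = n := Real.sq_sqrt (by positivity)
    have h4 : 1 / √((n : ℝ) + 1) ≤ 2 * √((n : ℝ) + 1) - 2 * √(n : ℝ) := by
      rw [div_le_iff₀ h1]
      nlinarith [sq_nonneg (√((n : ℝ) + 1) - √(n : ℝ))]
    linarith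

/-- A decay rate n^{-1/2} is far from sharp but reproduces itself under averaging, and becomes
summable after division by n. -/
theorem liCoeff_norm_le {N : ℕ} (hN : N ≠ 0) {w : List ℂ} (h : Admissible N w) :
    ∃ C : ℝ, 0 ≤ C ∧ ∀ n, ‖liCoeff w n‖ ≤ C * (1 / √((n : ℝ) + 1)) := by
  induction w with
  | nil =>
    refine ⟨1, zero_le_one, fun n => ?_⟩
    rcases Nat.eq_zero_or_pos n with rfl | hn
    · simp [liCoeff]
    · simp [liCoeff, hn.ne']
  | cons a w ih =>
    obtain ⟨C, hC, hw⟩ := ih h.2.2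
    -- One factor 2 comes from `sum_inv_sqrt_le`, the other from √n √(n+1) ≤ 2n.
    refine ⟨4 * C, by positivity, fun n => ?_⟩
    rcases Nat.eq_zero_or_pos n with rfl | hn
    · rw [liCoeff_cons_zero]
      simpa using hC
    have hn1 : (1 : ℝ) ≤ n := by exact_mod_cast hn
    by_cases ha : a = 0
    · simp only [liCoeff, ha, if_true, norm_div, Complex.norm_natCast]
      calc ‖liCoeff w n‖ / n ≤ ‖liCoeff w n‖ := div_le_self (norm_nonneg _) hn1
        _ ≤ C * (1 / √((n : ℝ) + 1)) := hw n
        _ ≤ _ := by gcongr; linarith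
    · have ha1 := norm_letter hN h.1 ha
      simp only [liCoeff, if_neg ha, norm_div, norm_neg, Complex.norm_natCast]
      have hs : ‖∑ m ∈ Finset.range n, liCoeff w m * a⁻¹ ^ (n - m)‖ ≤ C * (2 * √(n : ℝ)) := by
        refine (norm_sum_le _ _).trans ?_
        calc _ ≤ ∑ m ∈ Finset.range n, C * (1 / √((m : ℝ) + 1)) := by
              refine Finset.sum_le_sum fun m _ => ?_
              simpa [ha1] using hw m
          _ ≤ _ := by
              rw [← Finset.mul_sum]
              exact mul_le_mul_of_nonneg_left (sum_inv_sqrt_le n) hC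
      have h1 : 0 < √((n : ℝ) + 1) := Real.sqrt_pos.2 (by positivity)
      have h2 : √((n : ℝ) + 1) ^ 2 = n + 1 := Real.sq_sqrt (by positivity)
      have h3 : √(n : ℝ) ^ 2 = n := Real.sq_sqrt (by positivity)
      have h4 : √(n : ℝ) * √((n : ℝ) + 1) ≤ 2 * n := by
        nlinarith [sq_nonneg (√((n : ℝ) + 1) - √(n : ℝ))]
      rw [div_le_iff₀ (by linarith), mul_one_div, div_mul_eq_mul_div, le_div_iff₀ h1]
      calc _ ≤ C * (2 * √(n : ℝ)) * √((n : ℝ) + 1) := by gcongr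
        _ ≤ _ := by nlinarith

theorem summable_inv_mul_sqrt : Summable fun n : ℕ => (1 / √((n : ℝ) + 1)) / n := by
  have h : Summable fun n : ℕ => 1 / (n : ℝ) ^ (3 / 2 : ℝ) :=
    Real.summable_one_div_nat_rpow.2 (by norm_num)
  refine h.of_nonneg_of_le (fun n => by positivity) fun n => ?_
  rcases Nat.eq_zero_or_pos n with rfl | hn
  · simp
  have hn0 : (0 : ℝ) < n := by exact_mod_cast hn
  rw [div_div, show (3 / 2 : ℝ) = 1 / 2 + 1 by norm_num, Real.rpow_add hn0, Real.rpow_one,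
    ← Real.sqrt_eq_rpow]
  gcongr
  linarith

theorem tendsto_liCoeff {N : ℕ} (hN : N ≠ 0) {w : List ℂ} (h : Admissible N w) :
    Tendsto (liCoeff w) atTop (𝓝 0) := by
  obtain ⟨C, -, hw⟩ := liCoeff_norm_le hN h
  refine squeeze_zero_norm hw ?_
  rw [← mul_zero C]
  refine Tendsto.const_mul C ?_
  simp only [one_div]
  refine tendsto_inv_atTop_zero.comp (Real.tendsto_sqrt_atTop.comp ?_)
  exact tendsto_atTop_add_const_right _ _ tendsto_natCast_atTop_atTop

theorem summable_liCoeff_div {N : ℕ} (hN : N ≠ 0) {w : List ℂ} (h : Admissible N w) :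
    Summable fun n : ℕ => liCoeff w n / n := by
  obtain ⟨C, -, hw⟩ := liCoeff_norm_le hN h
  refine Summable.of_norm_bounded (summable_inv_mul_sqrt.mul_left C) fun n => ?_
  rw [norm_div, Complex.norm_natCast, ← mul_div_assoc]
  gcongr
  exact hw n

/-- The Taylor series of an admissible word that does not end in the letter `1` converges at `1`. -/
theorem exists_tendsto_sum_liCoeff {N : ℕ} (hN : N ≠ 0) {w : List ℂ} (h : Admissible N w)
    (h1 : w.head? ≠ some 1) :
    ∃ L, Tendsto (fun M => ∑ n ∈ Finset.range M, liCoeff w n) atTop (𝓝 L) := by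
  cases w with
  | nil =>
    refine ⟨1, tendsto_const_nhds.congr' ?_⟩
    filter_upwards [eventually_ge_atTop 1] with M hM
    have : 0 < M := hM
    simp [liCoeff, this]
  | cons a w =>
    by_cases ha : a = 0
    · refine ⟨_, (summable_liCoeff_div hN h.2.2).hasSum.tendsto_sum_nat.congr fun M => ?_⟩
      simp [liCoeff, ha]
    · have ha1 : 1 - a ≠ 0 := fun h0 => h1 (by simp [sub_eq_zero.1 h0])
      set g := liCoeff (a :: w) with hg
      -- By the recurrence the summand is (`liCoeff w n` + a g(n+1)) / n for n ≥ 1, which is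
      -- absolutely summable. The shift by 1 below avoids n = 0.
      have hsum : Summable fun n : ℕ => g n - a * g (n + 1) := by
        obtain ⟨C, hC, hb⟩ := liCoeff_norm_le hN h
        have hs : Summable fun n : ℕ => g (n + 1) / n := by
          refine Summable.of_norm_bounded (summable_inv_mul_sqrt.mul_left C) fun n => ?_
          rw [norm_div, Complex.norm_natCast, ← mul_div_assoc]
          gcongr
          refine (hb (n + 1)).trans ?_
          gcongr
          linarith
        have := (summable_liCoeff_div hN h.2.2).add (hs.mul_left a)
        refine (summable_nat_add_iff 1).1 (((summable_nat_add_iff 1).2 this).congr fun n => ?_)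
        have hr := liCoeff_recurrence h (n + 1)
        have hn : ((n + 1 : ℕ) : ℂ) ≠ 0 := by exact_mod_cast n.succ_ne_zero
        rw [← hr]
        field_simp
        push_cast
        ring
      -- Summation by parts: the partial sums of g(n) - a g(n+1) are (1 - a) times those of g plus
      -- boundary terms, and 1 - a ≠ 0.
      have hlim := ((hsum.hasSum.tendsto_sum_nat.add
        ((tendsto_liCoeff hN h).const_mul a)).sub_const (a * g 0)).const_mul (1 - a)⁻¹
      refine ⟨_, hlim.congr fun M => ?_⟩
      rw [inv_mul_eq_iff_eq_mul₀ ha1, Finset.sum_sub_distrib, ← Finset.mul_sum]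
      have e1 := Finset.sum_range_succ g M
      have e2 := Finset.sum_range_succ' g M
      have : ∑ i ∈ Finset.range M, g (i + 1) = ∑ n ∈ Finset.range M, g n + g M - g 0 := by
        rw [← e1, e2]; ring
      rw [this]
      ring

/-! ### The sum of the Taylor series in the unit disc -/

/-- The sum of the Taylor series attached to a word. -/
def liFun (w : List ℂ) (z : ℂ) : ℂ := ∑' n, liCoeff w n * z ^ n

theorem liCoeff_bounded {N : ℕ} (hN : N ≠ 0) {w : List ℂ} (h : Admissible N w) :
    ∃ C : ℝ, 0 ≤ C ∧ ∀ n, ‖liCoeff w n‖ ≤ C := by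
  obtain ⟨C, hC, hw⟩ := liCoeff_norm_le hN h
  refine ⟨C, hC, fun n => (hw n).trans (mul_le_of_le_one_right hC ?_)⟩
  rw [div_le_one (by positivity), Real.one_le_sqrt]
  simp

theorem summable_norm_liCoeff {N : ℕ} (hN : N ≠ 0) {w : List ℂ} (h : Admissible N w) {z : ℂ}
    (hz : ‖z‖ < 1) : Summable fun n => ‖liCoeff w n * z ^ n‖ := by
  obtain ⟨C, hC, hw⟩ := liCoeff_bounded hN h
  refine ((summable_geometric_of_lt_one (norm_nonneg z) hz).mul_left C).of_nonneg_of_le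
    (fun n => norm_nonneg _) fun n => ?_
  rw [norm_mul, norm_pow]
  gcongr
  exact hw n

theorem liFun_hasDerivAt_tsum {N : ℕ} (hN : N ≠ 0) {w : List ℂ} (h : Admissible N w) {z : ℂ}
    (hz : ‖z‖ < 1) :
    HasDerivAt (liFun w) (∑' n : ℕ, liCoeff w n * (n * z ^ (n - 1))) z ∧
      Summable fun n : ℕ => liCoeff w n * (n * z ^ (n - 1)) := by
  obtain ⟨C, hC, hw⟩ := liCoeff_bounded hN h
  obtain ⟨ρ, hzρ, hρ⟩ := exists_between hz
  have hρ0 : 0 ≤ ρ := (norm_nonneg z).trans hzρ.le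
  have hρpos : 0 < ρ := (norm_nonneg z).trans_lt hzρ
  have hu : Summable fun n : ℕ => C * (n * ρ ^ (n - 1)) := by
    have := summable_pow_mul_geometric_of_norm_lt_one 1
      (show ‖ρ‖ < 1 by rwa [Real.norm_of_nonneg hρ0])
    refine ((this.mul_left (C / ρ)).congr fun n => ?_)
    cases n with
    | zero => simp
    | succ n =>
      rw [Nat.add_sub_cancel, pow_one, pow_succ]
      field_simp
  have hb : ∀ (n : ℕ) (y : ℂ), y ∈ Metric.ball (0 : ℂ) ρ →
      ‖liCoeff w n * (n * y ^ (n - 1))‖ ≤ C * (n * ρ ^ (n - 1)) := by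
    intro n y hy
    have hy' : ‖y‖ ≤ ρ := (mem_ball_zero_iff.1 hy).le
    rw [norm_mul, norm_mul, norm_pow, Complex.norm_natCast]
    gcongr
    exact hw n
  have hzb : z ∈ Metric.ball (0 : ℂ) ρ := mem_ball_zero_iff.2 hzρ
  refine ⟨hasDerivAt_tsum_of_isPreconnected hu Metric.isOpen_ball
    (convex_ball (0 : ℂ) ρ).isPreconnected (fun n y _ => (hasDerivAt_pow n y).const_mul _) hb hzb
    (summable_norm_liCoeff hN h hz).of_norm hzb, Summable.of_norm_bounded hu fun n => hb n z hzb⟩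

theorem liFun_hasDerivAt {N : ℕ} (hN : N ≠ 0) {a : ℂ} {w : List ℂ} (h : Admissible N (a :: w))
    {z : ℂ} (hz : ‖z‖ < 1) (hza : z ≠ a) :
    HasDerivAt (liFun (a :: w)) (liFun w z / (z - a)) z := by
  obtain ⟨h1, h2⟩ := liFun_hasDerivAt_tsum hN h hz
  convert h1 using 1
  rw [div_eq_iff (sub_ne_zero.2 hza), mul_comm, sub_mul, ← tsum_mul_left]
  have e : ∑' n : ℕ, liCoeff (a :: w) n * (n * z ^ (n - 1)) =
      ∑' n : ℕ, liCoeff (a :: w) (n + 1) * ((n + 1 : ℕ) * z ^ n) := by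
    rw [h2.tsum_eq_zero_add]
    simp
  have h3 : Summable fun n : ℕ => liCoeff (a :: w) (n + 1) * ((n + 1 : ℕ) * z ^ n) :=
    ((summable_nat_add_iff 1).2 h2).congr fun n => by simp
  rw [e, ← tsum_mul_left, ← (h2.mul_left z).tsum_sub (h3.mul_left a), liFun]
  refine tsum_congr fun n => ?_
  rw [← liCoeff_recurrence h n]
  cases n with
  | zero => simp
  | succ n =>
    rw [Nat.add_sub_cancel]
    ring

theorem liFun_nil (z : ℂ) : liFun [] z = 1 := by
  rw [liFun, tsum_eq_single 0 (fun n hn => by simp [liCoeff, hn])]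
  simp [liCoeff]

theorem liFun_cons_zero (a : ℂ) (w : List ℂ) : liFun (a :: w) 0 = 0 := by
  rw [liFun, tsum_eq_single 0 (fun n hn => by simp [hn])]
  simp [liCoeff_cons_zero]

theorem ofReal_ne_letter {N : ℕ} (hN : N ≠ 0) {a : ℂ} (ha : a = 0 ∨ a ^ N = 1) {t : ℝ}
    (ht : t ∈ Set.Ioo (0 : ℝ) 1) : (t : ℂ) ≠ a := by
  rintro rfl
  have h0 : (t : ℂ) ≠ 0 := by exact_mod_cast ht.1.ne'
  have := norm_letter hN ha h0
  rw [Complex.norm_real, Real.norm_of_nonneg ht.1.le] at this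
  exact ht.2.ne this

theorem norm_ofReal_lt_one {t : ℝ} (h0 : 0 ≤ t) (h1 : t < 1) : ‖(t : ℂ)‖ < 1 := by
  rwa [Complex.norm_real, Real.norm_of_nonneg h0]

theorem liFun_hasDerivAt_real {N : ℕ} (hN : N ≠ 0) {a : ℂ} {w : List ℂ}
    (h : Admissible N (a :: w)) {t : ℝ} (ht : t ∈ Set.Ioo (0 : ℝ) 1) :
    HasDerivAt (fun s : ℝ => liFun (a :: w) s) (liFun w t / (t - a)) t :=
  (liFun_hasDerivAt hN h (norm_ofReal_lt_one ht.1.le ht.2)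
    (ofReal_ne_letter hN h.1 ht)).comp_ofReal

theorem liFun_mul {N : ℕ} (hN : N ≠ 0) {u v : List ℂ} (hu : Admissible N u)
    (hv : Admissible N v) {z : ℂ} (hz : ‖z‖ < 1) :
    liFun u z * liFun v z = shuffleSum (fun w => liFun w z) u v := by
  have e : liFun u z * liFun v z =
      ∑' n, PowerSeries.coeff n (shuffleSum liSeries u v) * z ^ n := by
    rw [liFun, liFun, tsum_mul_tsum_eq_tsum_sum_antidiagonal_of_summable_norm
      (summable_norm_liCoeff hN hu hz) (summable_norm_liCoeff hN hv hz), ← liSeries_mul hu hv]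
    refine tsum_congr fun n => ?_
    rw [PowerSeries.coeff_mul, Finset.sum_mul]
    refine Finset.sum_congr rfl fun p hp => ?_
    rw [← Finset.HasAntidiagonal.mem_antidiagonal.1 hp, pow_add]
    simp only [liSeries, PowerSeries.coeff_mk]
    ring
  have key : ∀ l : List (List ℂ), (∀ w ∈ l, Admissible N w) →
      HasSum (fun n => PowerSeries.coeff n (l.map liSeries).sum * z ^ n)
        (l.map fun w => liFun w z).sum := by
    intro l
    induction l with
    | nil => intro _; simp
    | cons w l ih =>
      intro hl
      have h1 := (summable_norm_liCoeff hN (hl w (by simp)) hz).of_norm.hasSum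
      have h2 := ih fun w hw => hl w (by simp [hw])
      refine (h1.add h2).congr_fun ?_
      intro n
      simp [liSeries, add_mul]
  rw [e]
  exact (key _ fun w hw => hu.of_mem_shuffles hv hw).tsum_eq


open Set MeasureTheory Asymptotics

/-! ### Iterated integrals starting at a positive point -/

theorem iterIntRev_continuousOn {N : ℕ} (hN : N ≠ 0) {w : List ℂ} (h : Admissible N w) {p : ℝ}
    (hp : p ∈ Ioo (0 : ℝ) 1) : ContinuousOn (iterIntRev w p) (Ioo 0 1) ∧
      ∀ a : ℂ, (a = 0 ∨ a ^ N = 1) → ∀ t ∈ Ioo (0 : ℝ) 1,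
        HasDerivAt (iterIntRev (a :: w) p) (iterIntRev w p t / (t - a)) t := by
  have key : ∀ w : List ℂ, ContinuousOn (iterIntRev w p) (Ioo 0 1) →
      ∀ a : ℂ, (a = 0 ∨ a ^ N = 1) → ∀ t ∈ Ioo (0 : ℝ) 1,
        HasDerivAt (iterIntRev (a :: w) p) (iterIntRev w p t / (t - a)) t := by
    intro w hw a ha t ht
    have hc : ContinuousOn (fun s : ℝ => iterIntRev w p s / ((s : ℂ) - a)) (Ioo 0 1) :=
      hw.div (by fun_prop) fun s hs => sub_ne_zero.2 (ofReal_ne_letter hN ha hs)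
    have hnhds : Ioo (0 : ℝ) 1 ∈ 𝓝 t := Ioo_mem_nhds ht.1 ht.2
    refine intervalIntegral.integral_hasDerivAt_right (ContinuousOn.intervalIntegrable
      (hc.mono ?_)) (hc.stronglyMeasurableAtFilter isOpen_Ioo t ht) (hc.continuousAt hnhds)
    exact ordConnected_Ioo.uIcc_subset hp ht
  have hcont : ContinuousOn (iterIntRev w p) (Ioo 0 1) := by
    induction w with
    | nil => exact continuousOn_const
    | cons a w ih =>
      exact fun t ht => (key w (ih h.2.2) a h.1 t ht).continuousAt.continuousWithinAt
  exact ⟨hcont, key w hcont⟩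

/-- A bound uniform in the letter, with explicit primitive log t - log(1 - t). -/
theorem norm_inv_sub_letter_le {N : ℕ} (hN : N ≠ 0) {a : ℂ} (ha : a = 0 ∨ a ^ N = 1) {t : ℝ}
    (ht : t ∈ Ioo (0 : ℝ) 1) : 1 / ‖(t : ℂ) - a‖ ≤ 1 / t + 1 / (1 - t) := by
  have h1 : 0 < 1 - t := sub_pos.2 ht.2
  have h2 := ht.1
  by_cases h0 : a = 0
  · rw [h0, sub_zero, Complex.norm_real, Real.norm_of_nonneg h2.le]
    have : 0 < 1 / (1 - t) := by positivity
    linarith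
  · have : 1 - t ≤ ‖(t : ℂ) - a‖ := by
      have := norm_sub_norm_le a (t : ℂ)
      rwa [norm_letter hN ha h0, Complex.norm_real, Real.norm_of_nonneg h2.le,
        norm_sub_rev] at this
    calc 1 / ‖(t : ℂ) - a‖ ≤ 1 / (1 - t) := by gcongr
      _ ≤ _ := by
        have : 0 < 1 / t := by positivity
        linarith

theorem liFun_cons_isBigO {N : ℕ} (hN : N ≠ 0) {a : ℂ} {w : List ℂ}
    (h : Admissible N (a :: w)) :
    ∃ C : ℝ, 0 ≤ C ∧ ∀ᶠ z : ℝ in 𝓝[>] 0, ‖liFun (a :: w) z‖ ≤ C * z := by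
  have hd := (liFun_hasDerivAt_tsum hN h (z := ((0 : ℝ) : ℂ)) (by simp)).1.comp_ofReal
  have hO := hd.isBigO_sub
  obtain ⟨C, hC, hb⟩ := hO.exists_nonneg
  refine ⟨C, hC, ?_⟩
  filter_upwards [nhdsWithin_le_nhds hb.bound, self_mem_nhdsWithin] with z hz hz0
  simpa [liFun_cons_zero, abs_of_pos (show (0 : ℝ) < z from hz0)] using hz

/-- Moving the lower limit from 0 to z costs O(z) at t = z, and each further integration over [z, 1
- z] costs at most one factor of order log z. Uniformity in t carries the induction. -/
theorem iterIntRev_sub_liFun_le {N : ℕ} (hN : N ≠ 0) {w : List ℂ} (h : Admissible N w) :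
    ∃ C : ℝ, 0 ≤ C ∧ ∀ᶠ z : ℝ in 𝓝[>] 0, ∀ t ∈ Icc z (1 - z),
      ‖iterIntRev w z t - liFun w t‖ ≤ C * (z * (1 - Real.log z) ^ w.length) := by
  induction w with
  | nil =>
    refine ⟨0, le_rfl, Eventually.of_forall fun z t _ => ?_⟩
    simp [iterIntRev, liFun_nil]
  | cons a w ih =>
    obtain ⟨C, hC, hw⟩ := ih h.2.2
    obtain ⟨C', hC', hw'⟩ := liFun_cons_isBigO hN h
    refine ⟨2 * C + C', by positivity, ?_⟩
    filter_upwards [hw, hw', self_mem_nhdsWithin,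
      nhdsWithin_le_nhds (gt_mem_nhds (show (0 : ℝ) < 1 / 2 by norm_num))]
      with z hz hz' hz0 hz1 t ht
    replace hz0 : 0 < z := hz0
    set M := C * (z * (1 - Real.log z) ^ w.length) with hM
    have hlog : Real.log z < 0 := Real.log_neg hz0 (by linarith)
    have hM0 : 0 ≤ M := by
      have : 0 ≤ 1 - Real.log z := by linarith
      positivity
    have hI : ∀ x ∈ Icc z (1 - z), x ∈ Ioo (0 : ℝ) 1 := fun x hx =>
      ⟨hz0.trans_le hx.1, by linarith [hx.2]⟩
    have hd : ∀ x ∈ Icc z (1 - z), HasDerivAt (fun s => iterIntRev (a :: w) z s - liFun (a :: w) s)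
        ((iterIntRev w z x - liFun w x) / (x - a)) x := by
      intro x hx
      rw [sub_div]
      exact ((iterIntRev_continuousOn hN h.2.2 (hI z ⟨le_rfl, by linarith⟩)).2 a h.1 x
        (hI x hx)).sub (liFun_hasDerivAt_real hN h (hI x hx))
    have hB : ∀ x ∈ Icc z (1 - z), HasDerivAt
        (fun s => M * ((Real.log s - Real.log (1 - s)) - (Real.log z - Real.log (1 - z))) +
          C' * z) (M * (1 / x + 1 / (1 - x))) x := by
      intro x hx
      have h1 := Real.hasDerivAt_log (hI x hx).1.ne'
      have h2 := ((hasDerivAt_id x).const_sub 1).log (sub_pos.2 (hI x hx).2).ne'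
      refine ((((h1.sub h2).sub_const _).const_mul M).add_const _).congr_deriv ?_
      simp only [id_eq]
      ring
    have := image_norm_le_of_norm_deriv_right_le_deriv_boundary'
      (f := fun s => iterIntRev (a :: w) z s - liFun (a :: w) s)
      (fun x hx => (hd x hx).continuousAt.continuousWithinAt)
      (fun x hx => (hd x (Ico_subset_Icc_self hx)).hasDerivWithinAt)
      (B := fun s => M * ((Real.log s - Real.log (1 - s)) - (Real.log z - Real.log (1 - z))) +
          C' * z)
      (by simpa [iterIntRev] using hz')
      (fun x hx => (hB x hx).continuousAt.continuousWithinAt)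
      (fun x hx => (hB x (Ico_subset_Icc_self hx)).hasDerivWithinAt)
      (by
        intro x hx
        have hx' := Ico_subset_Icc_self hx
        rw [norm_div, div_eq_mul_one_div]
        gcongr
        · exact hz x hx'
        · exact norm_inv_sub_letter_le hN h.1 (hI x hx')) ht
    refine this.trans ?_
    have ht' := hI t ht
    have l1 : Real.log t ≤ 0 := Real.log_nonpos ht'.1.le ht'.2.le
    have l2 : Real.log z ≤ Real.log (1 - t) := Real.log_le_log hz0 (by linarith [ht.2])
    have l3 : Real.log (1 - z) ≤ 0 := Real.log_nonpos (by linarith) (by linarith)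
    have l4 : (1 : ℝ) ≤ (1 - Real.log z) ^ (w.length + 1) := one_le_pow₀ (by linarith)
    rw [List.length_cons]
    -- The bracket is at most -2 log z, since 1 - t ≥ z.
    calc M * ((Real.log t - Real.log (1 - t)) - (Real.log z - Real.log (1 - z))) + C' * z
        ≤ M * (2 * (1 - Real.log z)) + C' * (z * (1 - Real.log z) ^ (w.length + 1)) := by
          gcongr
          · linarith
          · exact le_mul_of_one_le_right hz0.le l4
      _ = _ := by rw [hM, pow_succ]; ring

/-! ### Powers of the logarithm near `0` -/

theorem tendsto_log_nhdsGT_norm :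
    Tendsto (fun z : ℝ => ‖((Real.log z : ℝ) : ℂ)‖) (𝓝[>] 0) atTop := by
  simp only [Complex.norm_real]
  exact tendsto_abs_atBot_atTop.comp Real.tendsto_log_nhdsGT_zero

theorem polynomial_log_isLittleO (P : Polynomial ℂ) {r : ℝ} (hr : r < 0) :
    (fun s : ℝ => P.eval ((Real.log s : ℝ) : ℂ)) =o[𝓝[>] 0] fun s : ℝ => s ^ r := by
  induction P using Polynomial.induction_on' with
  | add p q hp hq => simpa using hp.add hq
  | monomial n a =>
    simp only [Polynomial.eval_monomial]
    refine IsLittleO.const_mul_left ?_ a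
    refine IsLittleO.of_norm_left ?_
    refine (isLittleO_abs_log_rpow_rpow_nhdsGT_zero n hr).congr_left fun s => ?_
    rw [Real.rpow_natCast, norm_pow, Complex.norm_real, Real.norm_eq_abs]

theorem tendsto_mul_polynomial_log (P : Polynomial ℂ) {r : ℝ} (hr : 0 < r) :
    Tendsto (fun s : ℝ => ‖P.eval ((Real.log s : ℝ) : ℂ)‖ * s ^ r) (𝓝[>] 0) (𝓝 0) := by
  have h := (polynomial_log_isLittleO P (neg_lt_zero.2 hr)).norm_left.tendsto_div_nhds_zero
  refine h.congr' ?_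
  filter_upwards [self_mem_nhdsWithin] with s hs
  rw [Real.rpow_neg (le_of_lt hs), div_inv_eq_mul]

/-- Uniqueness of logarithmic expansions: a nonconstant polynomial is unbounded along log z → -∞. -/
theorem polynomial_eq_zero_of_tendsto_log {P : Polynomial ℂ}
    (h : Tendsto (fun z : ℝ => P.eval ((Real.log z : ℝ) : ℂ)) (𝓝[>] 0) (𝓝 0)) : P = 0 := by
  by_cases hd : 0 < P.degree
  · exact absurd (P.tendsto_norm_atTop hd tendsto_log_nhdsGT_norm)
      (not_tendsto_atTop_of_tendsto_nhds h.norm)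
  · rw [Polynomial.eq_C_of_degree_le_zero (not_lt.1 hd)] at h ⊢
    simp only [Polynomial.eval_C] at h
    rw [tendsto_nhds_unique tendsto_const_nhds h, Polynomial.C_0]

theorem tendsto_iterIntRev_sub_liFun {N : ℕ} (hN : N ≠ 0) {w : List ℂ} (h : Admissible N w) :
    Tendsto (fun z : ℝ => iterIntRev w z (1 - z) - liFun w ((1 - z : ℝ) : ℂ)) (𝓝[>] 0) (𝓝 0) := by
  obtain ⟨C, hC, hw⟩ := iterIntRev_sub_liFun_le hN h
  refine squeeze_zero_norm' (a := fun z => C * (z * (1 - Real.log z) ^ w.length)) ?_ ?_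
  · filter_upwards [hw, nhdsWithin_le_nhds (gt_mem_nhds (show (0 : ℝ) < 1 / 2 by norm_num))]
      with z hz hz1
    exact hz _ ⟨by linarith, le_rfl⟩
  · suffices Tendsto (fun z => z * (1 - Real.log z) ^ w.length) (𝓝[>] 0) (𝓝 0) by
      simpa using this.const_mul C
    have := tendsto_mul_polynomial_log ((1 - Polynomial.X) ^ w.length) one_pos
    refine this.congr' ?_
    filter_upwards [self_mem_nhdsWithin,
      nhdsWithin_le_nhds (gt_mem_nhds (show (0 : ℝ) < 1 by norm_num))] with z hz hz1
    have hlog : Real.log z < 0 := Real.log_neg hz hz1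
    simp only [Polynomial.eval_pow, Polynomial.eval_sub, Polynomial.eval_one, Polynomial.eval_X,
      norm_pow, Real.rpow_one]
    rw [← Complex.ofReal_one, ← Complex.ofReal_sub, Complex.norm_real,
      Real.norm_of_nonneg (by linarith)]
    ring

/-! ### Logarithmic asymptotics at `1` -/

/-- A function on `(0, 1)` equals a polynomial in `log (1 - t)` up to `O(√(1 - t))` as `t → 1`. -/
def HasLogAsymptotics (f : ℝ → ℂ) (P : Polynomial ℂ) : Prop :=
  (fun s : ℝ => f (1 - s) - P.eval ((Real.log s : ℝ) : ℂ)) =O[𝓝[>] 0] fun s : ℝ => √s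

/-- The singularity 1/√s is integrable with primitive 2√s, so k is Cauchy at 0 with error O(√s). -/
theorem exists_limit_of_deriv_isBigO {k k' : ℝ → ℂ}
    (hd : ∀ s ∈ Ioo (0 : ℝ) 1, HasDerivAt k (k' s) s)
    (hO : k' =O[𝓝[>] 0] fun s : ℝ => 1 / √s) :
    ∃ L, (fun s => k s - L) =O[𝓝[>] 0] fun s : ℝ => √s := by
  obtain ⟨C, hC, hb⟩ := hO.exists_nonneg
  obtain ⟨δ, hδ0, hδ⟩ := mem_nhdsGT_iff_exists_Ioo_subset.1
    (inter_mem hb.bound (Ioo_mem_nhdsGT (show (0 : ℝ) < 1 by norm_num)))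
  replace hδ0 : 0 < δ := hδ0
  have hmv : ∀ s s', 0 < s → s ≤ s' → s' < δ → ‖k s' - k s‖ ≤ 2 * C * √s' := by
    intro s s' hs hss hs'
    have hI : ∀ x ∈ Icc s s', x ∈ Ioo 0 δ := fun x hx =>
      ⟨hs.trans_le hx.1, hx.2.trans_lt hs'⟩
    have hk : ∀ x ∈ Icc s s', HasDerivAt (fun x => k x - k s) (k' x) x := fun x hx =>
      (hd x (hδ (hI x hx)).2).sub_const _
    have hB : ∀ x ∈ Icc s s', HasDerivAt (fun x => 2 * C * (√x - √s)) (C * (1 / √x)) x := by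
      intro x hx
      refine (((Real.hasDerivAt_sqrt (hI x hx).1.ne').sub_const _).const_mul (2 * C)).congr_deriv ?_
      have : 0 < √x := Real.sqrt_pos.2 (hI x hx).1
      field_simp
    have := image_norm_le_of_norm_deriv_right_le_deriv_boundary'
      (f := fun x => k x - k s)
      (fun x hx => (hk x hx).continuousAt.continuousWithinAt)
      (fun x hx => (hk x (Ico_subset_Icc_self hx)).hasDerivWithinAt)
      (B := fun x => 2 * C * (√x - √s)) (by simp)
      (fun x hx => (hB x hx).continuousAt.continuousWithinAt)
      (fun x hx => (hB x (Ico_subset_Icc_self hx)).hasDerivWithinAt)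
      (by
        intro x hx
        have := (hδ (hI x (Ico_subset_Icc_self hx))).1
        simpa [abs_of_nonneg (Real.sqrt_nonneg x)] using this)
      (right_mem_Icc.2 hss)
    refine this.trans ?_
    have := Real.sqrt_nonneg s
    gcongr
    linarith
  have hcauchy : Cauchy (map k (𝓝[>] 0)) := by
    rw [Metric.cauchy_iff]
    refine ⟨inferInstance, fun ε hε => ?_⟩
    have hlim : Tendsto (fun s : ℝ => 2 * C * √s) (𝓝[>] 0) (𝓝 0) := by
      have : Tendsto (fun s : ℝ => 2 * C * √s) (𝓝 0) (𝓝 (2 * C * √0)) :=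
        (Real.continuous_sqrt.tendsto 0).const_mul _
      rw [Real.sqrt_zero, mul_zero] at this
      exact this.mono_left nhdsWithin_le_nhds
    have hev := (hlim.eventually (gt_mem_nhds hε)).and (Ioo_mem_nhdsGT hδ0)
    refine ⟨k '' {s | 2 * C * √s < ε ∧ s ∈ Ioo 0 δ}, image_mem_map hev, ?_⟩
    rintro _ ⟨s, hs, rfl⟩ _ ⟨s', hs', rfl⟩
    rw [dist_eq_norm]
    rcases le_total s s' with hle | hle
    · rw [norm_sub_rev]
      exact (hmv s s' hs.2.1 hle hs'.2.2).trans_lt hs'.1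
    · exact (hmv s' s hs'.2.1 hle hs.2.2).trans_lt hs.1
  obtain ⟨L, hL⟩ := CompleteSpace.complete hcauchy
  refine ⟨L, IsBigO.of_bound (2 * C) ?_⟩
  filter_upwards [Ioo_mem_nhdsGT hδ0] with s hs
  rw [Real.norm_of_nonneg (Real.sqrt_nonneg s)]
  have ht : Tendsto (fun x => ‖k s - k x‖) (𝓝[>] 0) (𝓝 ‖k s - L‖) :=
    (tendsto_const_nhds.sub hL).norm
  refine le_of_tendsto ht ?_
  filter_upwards [Ioo_mem_nhdsGT hs.1] with x hx
  exact hmv x s hx.1 hx.2.le hs.2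

theorem exists_polynomial_primitive (P : Polynomial ℂ) :
    ∃ Q : Polynomial ℂ, Polynomial.derivative Q = P := by
  induction P using Polynomial.induction_on' with
  | add p q hp hq =>
    obtain ⟨p', rfl⟩ := hp
    obtain ⟨q', rfl⟩ := hq
    exact ⟨p' + q', by simp⟩
  | monomial n a =>
    refine ⟨Polynomial.monomial (n + 1) (a / (n + 1)), ?_⟩
    rw [Polynomial.derivative_monomial, Nat.add_sub_cancel]
    have : (n : ℂ) + 1 ≠ 0 := by exact_mod_cast n.succ_ne_zero
    congr 1
    push_cast
    field_simp

theorem sqrt_div_self_isBigO :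
    (fun s : ℝ => √s / s) =O[𝓝[>] 0] fun s : ℝ => 1 / √s := by
  refine IsBigO.of_bound 1 ?_
  filter_upwards with s
  rw [Real.sqrt_div_self', one_mul]

/-- The error √s survives division by s as the integrable 1/√s. Only the letter 1 can raise the
degree in log s. -/
theorem HasLogAsymptotics.integrate {f g : ℝ → ℂ} {P : Polynomial ℂ} {a : ℂ}
    (hf : HasLogAsymptotics f P)
    (hg : ∀ t ∈ Ioo (0 : ℝ) 1, HasDerivAt g (f t / (t - a)) t) :
    ∃ Q, HasLogAsymptotics g Q := by
  have hg' : ∀ s ∈ Ioo (0 : ℝ) 1,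
      HasDerivAt (fun s => g (1 - s)) (-(f (1 - s) / ((1 - s : ℝ) - a))) s := by
    intro s hs
    have := hg (1 - s) ⟨by linarith [hs.2], by linarith [hs.1]⟩
    have h2 := this.scomp s ((hasDerivAt_id s).const_sub 1)
    simpa [Function.comp_def] using h2
  by_cases ha : a = 1
  · subst ha
    -- With s = 1 - t the form dt/(t - 1) becomes ds/s, so a primitive Q of P absorbs the
    -- logarithmic part.
    obtain ⟨Q, hQ⟩ := exists_polynomial_primitive P
    have hd : ∀ s ∈ Ioo (0 : ℝ) 1,
        HasDerivAt (fun s => g (1 - s) - Q.eval ((Real.log s : ℝ) : ℂ))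
          ((f (1 - s) - P.eval ((Real.log s : ℝ) : ℂ)) * ((1 / s : ℝ) : ℂ)) s := by
      intro s hs
      have hlog : HasDerivAt (fun s : ℝ => ((Real.log s : ℝ) : ℂ)) ((s⁻¹ : ℝ) : ℂ) s :=
        (Real.hasDerivAt_log hs.1.ne').ofReal_comp
      have h2 := (Q.hasDerivAt ((Real.log s : ℝ) : ℂ)).comp s hlog
      rw [hQ] at h2
      refine ((hg' s hs).sub h2).congr_deriv ?_
      have : (s : ℂ) ≠ 0 := by exact_mod_cast hs.1.ne'
      push_cast
      rw [show (1 : ℂ) - s - 1 = -s by ring]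
      field_simp
    have hO : (fun s => (f (1 - s) - P.eval ((Real.log s : ℝ) : ℂ)) * ((1 / s : ℝ) : ℂ))
        =O[𝓝[>] 0] fun s : ℝ => 1 / √s := by
      have h1 : (fun s : ℝ => ((1 / s : ℝ) : ℂ)) =O[𝓝[>] 0] fun s : ℝ => 1 / s :=
        IsBigO.of_bound 1 (Eventually.of_forall fun s => by
          rw [Complex.norm_real, one_mul])
      refine (hf.mul h1).trans ?_
      simpa [div_eq_mul_inv] using sqrt_div_self_isBigO
    obtain ⟨L, hL⟩ := exists_limit_of_deriv_isBigO hd hO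
    refine ⟨Q + Polynomial.C L, hL.congr_left fun s => ?_⟩
    simp
    ring
  -- Here 1/(t - a) is bounded near 1 and powers of log s are O(1/√s), so g has a finite limit.
  · have hO : (fun s => -(f (1 - s) / ((1 - s : ℝ) - a))) =O[𝓝[>] 0] fun s : ℝ => 1 / √s := by
      have h1 : (fun s : ℝ => (((1 - s : ℝ) : ℂ) - a)⁻¹) =O[𝓝[>] 0] fun _ => (1 : ℝ) := by
        have : Tendsto (fun s : ℝ => (((1 - s : ℝ) : ℂ) - a)⁻¹) (𝓝 0)
            (𝓝 (((1 - 0 : ℝ) : ℂ) - a)⁻¹) := by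
          refine Tendsto.inv₀ ?_ (by simpa [sub_eq_zero] using fun h => ha h.symm)
          exact Continuous.tendsto (by fun_prop) 0
        exact (this.mono_left nhdsWithin_le_nhds).isBigO_one ℝ
      have h2 : (fun s : ℝ => P.eval ((Real.log s : ℝ) : ℂ)) =O[𝓝[>] 0] fun s : ℝ => 1 / √s := by
        refine (polynomial_log_isLittleO P (show (-(1 / 2) : ℝ) < 0 by norm_num)).isBigO.congr'
          EventuallyEq.rfl ?_
        filter_upwards [self_mem_nhdsWithin] with s hs
        rw [Real.rpow_neg (le_of_lt hs), ← Real.sqrt_eq_rpow, one_div]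
      have h3 : (fun s : ℝ => √s) =O[𝓝[>] 0] fun s : ℝ => 1 / √s := by
        refine IsBigO.of_bound 1 ?_
        filter_upwards [Ioo_mem_nhdsGT (show (0 : ℝ) < 1 by norm_num)] with s hs
        have h4 : 0 < √s := Real.sqrt_pos.2 hs.1
        have h5 : √s ≤ 1 := Real.sqrt_le_one.2 hs.2.le
        rw [Real.norm_of_nonneg h4.le, Real.norm_of_nonneg (by positivity), one_mul,
          le_div_iff₀ h4]
        nlinarith
      have h4 : (fun s : ℝ => f (1 - s)) =O[𝓝[>] 0] fun s : ℝ => 1 / √s :=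
        ((hf.trans h3).add h2).congr_left fun s => by ring
      refine (h4.mul h1).neg_left.congr (fun s => ?_) fun s => ?_
      · rw [div_eq_mul_inv]
      · rw [mul_one]
    obtain ⟨L, hL⟩ := exists_limit_of_deriv_isBigO hg' hO
    exact ⟨Polynomial.C L, by simpa [HasLogAsymptotics] using hL⟩

theorem exists_hasLogAsymptotics {N : ℕ} (hN : N ≠ 0) {w : List ℂ} (h : Admissible N w) :
    ∃ P, HasLogAsymptotics (fun t => liFun w t) P := by
  induction w with
  | nil =>
    refine ⟨1, ?_⟩
    simp only [HasLogAsymptotics, liFun_nil, Polynomial.eval_one, sub_self]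
    exact isBigO_zero _ _
  | cons a w ih =>
    obtain ⟨P, hP⟩ := ih h.2.2
    exact hP.integrate fun t ht => liFun_hasDerivAt_real hN h ht

theorem tendsto_sqrt_nhdsGT : Tendsto (fun s : ℝ => √s) (𝓝[>] 0) (𝓝 0) := by
  have := Real.continuous_sqrt.tendsto 0
  rw [Real.sqrt_zero] at this
  exact this.mono_left nhdsWithin_le_nhds

theorem HasLogAsymptotics.tendsto {f : ℝ → ℂ} {P : Polynomial ℂ} (h : HasLogAsymptotics f P) :
    Tendsto (fun s : ℝ => f (1 - s) - P.eval ((Real.log s : ℝ) : ℂ)) (𝓝[>] 0) (𝓝 0) :=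
  h.trans_tendsto tendsto_sqrt_nhdsGT

/-! ### Regularized values -/

/-- The regularized iterated integral of a word written with the largest variable first. -/
def regIntRev (w : List ℂ) : ℂ := regInt w.reverse

theorem IsLogExpansion.regInt_eq {w : List ℂ} {P : Polynomial ℂ} (h : IsLogExpansion w P) :
    regInt w = P.coeff 0 := by
  have hex : ∃ P : Polynomial ℂ, IsLogExpansion w P := ⟨P, h⟩
  rw [regInt, dif_pos hex]
  have h2 := hex.choose_spec
  set Q := hex.choose
  have : Q - P = 0 := by
    refine polynomial_eq_zero_of_tendsto_log ?_
    have := Tendsto.sub h h2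
    rw [sub_zero] at this
    refine this.congr fun z => ?_
    rw [Polynomial.eval_sub]
    ring
  rw [sub_eq_zero.1 this]

/-- For admissible words the cutoff at 0 contributes o(1), so all logarithms come from the endpoint
1. -/
theorem regIntRev_eq_of_tendsto {N : ℕ} (hN : N ≠ 0) {w : List ℂ} (h : Admissible N w)
    {P : Polynomial ℂ} (hP : Tendsto (fun s : ℝ => liFun w ((1 - s : ℝ) : ℂ) -
      P.eval ((Real.log s : ℝ) : ℂ)) (𝓝[>] 0) (𝓝 0)) : regIntRev w = P.coeff 0 := by
  refine IsLogExpansion.regInt_eq ?_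
  have := (tendsto_iterIntRev_sub_liFun hN h).add hP
  rw [add_zero] at this
  refine this.congr fun z => ?_
  rw [iterInt, List.reverse_reverse]
  ring

/-- An error merely o(1) would not suffice: the cross terms multiply it by polynomials in log s,
which √s dominates. -/
theorem HasLogAsymptotics.mul {f g : ℝ → ℂ} {P Q : Polynomial ℂ} (hf : HasLogAsymptotics f P)
    (hg : HasLogAsymptotics g Q) :
    Tendsto (fun s : ℝ => f (1 - s) * g (1 - s) - (P * Q).eval ((Real.log s : ℝ) : ℂ))
      (𝓝[>] 0) (𝓝 0) := by
  have key : ∀ {f : ℝ → ℂ} {P Q : Polynomial ℂ}, HasLogAsymptotics f P →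
      Tendsto (fun s : ℝ => (f (1 - s) - P.eval ((Real.log s : ℝ) : ℂ)) *
        Q.eval ((Real.log s : ℝ) : ℂ)) (𝓝[>] 0) (𝓝 0) := by
    intro f P Q hf
    have h1 := hf.mul_isLittleO (polynomial_log_isLittleO Q (show (-(1 / 2) : ℝ) < 0 by norm_num))
    refine (isLittleO_one_iff ℝ).1 (h1.congr' EventuallyEq.rfl ?_)
    filter_upwards [self_mem_nhdsWithin] with s hs
    rw [Real.rpow_neg (le_of_lt hs), ← Real.sqrt_eq_rpow]
    exact mul_inv_cancel₀ (Real.sqrt_pos.2 hs).ne'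
  have := ((hf.tendsto.mul hg.tendsto).add (key (Q := Q) hf)).add (key (Q := P) hg)
  rw [mul_zero, add_zero, add_zero] at this
  refine this.congr fun s => ?_
  rw [Polynomial.eval_mul]
  ring

/-- Regularized iterated integrals multiply by the shuffle product. -/
theorem regIntRev_mul {N : ℕ} (hN : N ≠ 0) {u v : List ℂ} (hu : Admissible N u)
    (hv : Admissible N v) : regIntRev u * regIntRev v = shuffleSum regIntRev u v := by
  obtain ⟨P, hP⟩ := exists_hasLogAsymptotics hN hu
  obtain ⟨Q, hQ⟩ := exists_hasLogAsymptotics hN hv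
  have key : ∀ l : List (List ℂ), (∀ w ∈ l, Admissible N w) → ∃ R : Polynomial ℂ,
      R.coeff 0 = (l.map regIntRev).sum ∧
      Tendsto (fun s : ℝ => (l.map fun w => liFun w ((1 - s : ℝ) : ℂ)).sum -
        R.eval ((Real.log s : ℝ) : ℂ)) (𝓝[>] 0) (𝓝 0) := by
    intro l
    induction l with
    | nil => exact fun _ => ⟨0, by simp, by simp⟩
    | cons w l ih =>
      intro hl
      obtain ⟨R, hR, hR'⟩ := ih fun w hw => hl w (by simp [hw])
      have hw := hl w (by simp)
      obtain ⟨P, hP⟩ := exists_hasLogAsymptotics hN hw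
      refine ⟨P + R, ?_, ?_⟩
      · rw [List.map_cons, List.sum_cons, regIntRev_eq_of_tendsto hN hw hP.tendsto, ← hR,
          Polynomial.coeff_add]
      · have := hP.tendsto.add hR'
        rw [add_zero] at this
        refine this.congr fun s => ?_
        simp only [List.map_cons, List.sum_cons, Polynomial.eval_add]
        ring
  obtain ⟨R, hR, hR'⟩ := key (shuffles u v) fun w hw => hu.of_mem_shuffles hv hw
  -- `liFun_mul` makes P Q and R expansions of the same function; uniqueness identifies them and
  -- hence their constant terms.
  have hPQR : P * Q - R = 0 := by
    refine polynomial_eq_zero_of_tendsto_log ?_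
    have := hR'.sub (hP.mul hQ)
    rw [sub_zero] at this
    refine this.congr' ?_
    filter_upwards [Ioo_mem_nhdsGT (show (0 : ℝ) < 1 by norm_num)] with s hs
    rw [liFun_mul hN hu hv (norm_ofReal_lt_one (by linarith [hs.2]) (by linarith [hs.1])),
      Polynomial.eval_sub, shuffleSum]
    ring
  rw [regIntRev_eq_of_tendsto hN hu hP.tendsto, regIntRev_eq_of_tendsto hN hv hQ.tendsto,
    shuffleSum, ← hR, ← sub_eq_zero.1 hPQR, Polynomial.mul_coeff_zero]

/-- For admissible words not ending in the letter `1` the regularized integral is the sum of the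
Taylor series at `1`. -/
theorem tendsto_sum_liCoeff {N : ℕ} (hN : N ≠ 0) {w : List ℂ} (h : Admissible N w)
    (h1 : w.head? ≠ some 1) :
    Tendsto (fun M => ∑ n ∈ Finset.range M, liCoeff w n) atTop (𝓝 (regIntRev w)) := by
  obtain ⟨L, hL⟩ := exists_tendsto_sum_liCoeff hN h h1
  -- Abel's limit theorem: the expansion at 1 is the constant L.
  have habel := tendsto_map'_iff.1 (Complex.tendsto_tsum_powerSeries_nhdsWithin_lt hL)
  have hs : Tendsto (fun s : ℝ => 1 - s) (𝓝[>] 0) (𝓝[<] 1) := by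
    refine tendsto_nhdsWithin_of_tendsto_nhds_of_eventually_within _ ?_ ?_
    · have : Tendsto (fun s : ℝ => 1 - s) (𝓝 0) (𝓝 (1 - 0)) :=
        Continuous.tendsto (by fun_prop) 0
      rw [sub_zero] at this
      exact this.mono_left nhdsWithin_le_nhds
    · filter_upwards [self_mem_nhdsWithin] with s hs
      exact sub_lt_self (1 : ℝ) hs
  have hreg := regIntRev_eq_of_tendsto hN h (P := Polynomial.C L) (by
    have := (habel.comp hs).sub_const L
    rw [sub_self] at this
    refine this.congr fun s => ?_
    simp [liFun])
  rwa [hreg, Polynomial.coeff_C_zero]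


/-! ### The series as sums over increasing tuples -/

/-- `word x k`, with the letter of the largest variable first. -/
def revWord {s : ℕ} (x : Fin s → ℂ) (k : Fin s → ℕ) : List ℂ := (word x k).reverse

theorem revWord_zero (x : Fin 0 → ℂ) (k : Fin 0 → ℕ) : revWord x k = [] := by
  simp [revWord, word]

theorem revWord_succ {s : ℕ} (x : Fin (s + 1) → ℂ) (k : Fin (s + 1) → ℕ) :
    revWord x k = List.replicate (k (Fin.last s) - 1) 0 ++
      (x (Fin.last s))⁻¹ :: revWord (fun j => x j.castSucc) fun j => k j.castSucc := by
  simp only [revWord, word]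
  rw [List.ofFn_succ', List.concat_eq_append, List.flatten_append, List.reverse_append]
  simp

theorem liCoeff_replicate_append (j : ℕ) (w : List ℂ) (m : ℕ) :
    liCoeff (List.replicate j 0 ++ w) m = liCoeff w m / (m : ℂ) ^ j := by
  induction j with
  | zero => simp
  | succ j ih =>
    rw [List.replicate_succ, List.cons_append, liCoeff, if_pos rfl, ih, pow_succ, div_div]

theorem mem_incTuples {s M : ℕ} (hM : 0 < M) {n : Fin s → ℕ} :
    n ∈ incTuples s M ↔ (StrictMono n ∧ ∀ j, 1 ≤ n j) ∧ top n < M := by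
  rw [incTuples, Finset.mem_filter, Fintype.mem_piFinset, top,
    Finset.sup_lt_iff (by simpa using hM)]
  simp only [Finset.mem_Ico, Finset.mem_univ, true_imp_iff, forall_and]
  tauto

theorem top_eq_last {s : ℕ} {n : Fin (s + 1) → ℕ} (h : StrictMono n) : top n = n (Fin.last s) :=
  le_antisymm (Finset.sup_le fun j _ => h.monotone (Fin.le_last j))
    (Finset.le_sup (Finset.mem_univ _))

/-- The increasing tuples of positive integers with largest entry `m`. -/
def incTuplesTop (s m : ℕ) : Finset (Fin s → ℕ) := (incTuples s (m + 1)).filter (top · = m)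

theorem mem_incTuplesTop {s m : ℕ} {n : Fin s → ℕ} :
    n ∈ incTuplesTop s m ↔ (StrictMono n ∧ ∀ j, 1 ≤ n j) ∧ top n = m := by
  rw [incTuplesTop, Finset.mem_filter, mem_incTuples (Nat.succ_pos m)]
  constructor
  · exact fun h => ⟨h.1.1, h.2⟩
  · exact fun h => ⟨⟨h.1, by omega⟩, h.2⟩

theorem prevEntry_castSucc {s : ℕ} (n : Fin (s + 1) → ℕ) (j : Fin s) :
    prevEntry n j.castSucc = prevEntry (fun i => n i.castSucc) j := by
  simp [prevEntry]

theorem prevEntry_last {s : ℕ} {n : Fin (s + 1) → ℕ} (h : StrictMono n) :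
    prevEntry n (Fin.last s) = top fun i => n i.castSucc := by
  cases s with
  | zero => simp [prevEntry, top]
  | succ s =>
    rw [top_eq_last (fun i j hij => h (Fin.castSucc_lt_castSucc_iff.2 hij))]
    simp only [prevEntry, Fin.val_last, Nat.succ_pos, if_true]
    congr 1

theorem liTerm_succ {s : ℕ} (x : Fin (s + 1) → ℂ) (k n : Fin (s + 1) → ℕ) (h : StrictMono n) :
    liTerm x k n = liTerm (fun j => x j.castSucc) (fun j => k j.castSucc) (fun j => n j.castSucc) *
      (x (Fin.last s) ^ (n (Fin.last s) - top fun j => n j.castSucc) /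
        (n (Fin.last s) : ℂ) ^ k (Fin.last s)) := by
  rw [liTerm, Fin.prod_univ_castSucc, prevEntry_last h, liTerm]
  simp only [prevEntry_castSucc]

theorem strictMono_snoc {s m : ℕ} {n : Fin s → ℕ} (h : StrictMono n) (hm : ∀ j, n j < m) :
    StrictMono (Fin.snoc n m : Fin (s + 1) → ℕ) := by
  intro i j hij
  induction j using Fin.lastCases with
  | last =>
    obtain ⟨i, rfl⟩ := Fin.exists_castSucc_eq.2 hij.ne
    simpa using hm i
  | cast j =>
    obtain ⟨i, rfl⟩ := Fin.exists_castSucc_eq.2 (hij.trans (Fin.castSucc_lt_last j)).ne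
    simpa using h (Fin.castSucc_lt_castSucc_iff.1 hij)

/-- Delete the largest entry m and group the tuples by their new largest entry i, with i = 0 for the
empty tuple. -/
theorem sum_incTuplesTop_succ {s m : ℕ} (x : Fin (s + 1) → ℂ) (k : Fin (s + 1) → ℕ) :
    ∑ n ∈ incTuplesTop (s + 1) m, liTerm x k n =
      ∑ i ∈ Finset.range m,
        (∑ n ∈ incTuplesTop s i, liTerm (fun j => x j.castSucc) (fun j => k j.castSucc) n) *
          (x (Fin.last s) ^ (m - i) / (m : ℂ) ^ k (Fin.last s)) := by
  rcases Nat.eq_zero_or_pos m with rfl | hm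
  · rw [Finset.range_zero, Finset.sum_empty]
    refine Finset.sum_eq_zero fun n hn => ?_
    have h := mem_incTuplesTop.1 hn
    rw [top_eq_last h.1.1] at h
    have := h.1.2 (Fin.last s)
    omega
  have hb : ∀ n ∈ incTuples s m, ∀ j, n j < m := fun n hn j =>
    (Finset.le_sup (f := n) (Finset.mem_univ j)).trans_lt ((mem_incTuples hm).1 hn).2
  have h1 : ∑ n ∈ incTuplesTop (s + 1) m, liTerm x k n = ∑ n ∈ incTuples s m,
      liTerm (fun j => x j.castSucc) (fun j => k j.castSucc) n *
        (x (Fin.last s) ^ (m - top n) / (m : ℂ) ^ k (Fin.last s)) := by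
    refine Finset.sum_bij' (fun n _ j => n j.castSucc) (fun n _ => Fin.snoc n m) ?_ ?_ ?_ ?_ ?_
    · intro n hn
      have h := mem_incTuplesTop.1 hn
      have hmono : StrictMono fun j : Fin s => n j.castSucc :=
        fun i j hij => h.1.1 (Fin.castSucc_lt_castSucc_iff.2 hij)
      refine (mem_incTuples hm).2 ⟨⟨hmono, fun j => h.1.2 _⟩, ?_⟩
      rw [top, Finset.sup_lt_iff (by simpa using hm)]
      intro j _
      rw [← h.2, top_eq_last h.1.1]
      exact h.1.1 (Fin.castSucc_lt_last j)
    · intro n hn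
      have h := (mem_incTuples hm).1 hn
      have hmono := strictMono_snoc h.1.1 (hb n hn)
      refine mem_incTuplesTop.2 ⟨⟨hmono, fun j => ?_⟩, ?_⟩
      · induction j using Fin.lastCases with
        | last => simpa using Nat.succ_le_of_lt hm
        | cast j => simpa using h.1.2 j
      · rw [top_eq_last hmono, Fin.snoc_last]
    · intro n hn
      have h := mem_incTuplesTop.1 hn
      rw [top_eq_last h.1.1] at h
      rw [← h.2]
      exact Fin.snoc_init_self n
    · intro n hn
      ext j
      simp
    · intro n hn
      have h := mem_incTuplesTop.1 hn
      rw [liTerm_succ x k n h.1.1, ← top_eq_last h.1.1, h.2]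
  rw [h1, ← Finset.sum_fiberwise_of_maps_to (g := top) (t := Finset.range m)
    (fun n hn => Finset.mem_range.2 ((mem_incTuples hm).1 hn).2)]
  refine Finset.sum_congr rfl fun i hi => ?_
  rw [Finset.sum_mul]
  refine Finset.sum_congr ?_ fun n hn => ?_
  · ext n
    have := Finset.mem_range.1 hi
    rw [Finset.mem_filter, mem_incTuples hm, mem_incTuplesTop]
    constructor
    · exact fun h => ⟨h.1.1, h.2⟩
    · exact fun h => ⟨⟨h.1, by omega⟩, h.2⟩
  · rw [(mem_incTuplesTop.1 hn).2]

/-- Both sides satisfy the same recursion. Each nonzero letter contributes one sign, from 1/(t - a)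
= -∑ a^{-j-1} t^j. -/
theorem sum_incTuplesTop {s : ℕ} (x : Fin s → ℂ) (k : Fin s → ℕ) (hx : ∀ j, x j ≠ 0)
    (hk : ∀ j, 1 ≤ k j) (m : ℕ) :
    ∑ n ∈ incTuplesTop s m, liTerm x k n = (-1) ^ s * liCoeff (revWord x k) m := by
  induction s generalizing m with
  | zero =>
    rw [revWord_zero, pow_zero, one_mul, liCoeff]
    by_cases hm : m = 0
    · subst hm
      have : incTuplesTop 0 0 = {Fin.elim0} := by
        ext n
        rw [mem_incTuplesTop, Finset.mem_singleton]
        simp [Subsingleton.elim n Fin.elim0, top, Subsingleton.strictMono]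
      simp [this, liTerm]
    · rw [if_neg hm]
      refine Finset.sum_eq_zero fun n hn => ?_
      have := (mem_incTuplesTop.1 hn).2
      simp only [top, Finset.univ_eq_empty, Finset.sup_empty, bot_eq_zero'] at this
      exact absurd this.symm hm
  | succ s ih =>
    rw [sum_incTuplesTop_succ, revWord_succ, liCoeff_replicate_append, liCoeff,
      if_neg (inv_ne_zero (hx _)), inv_inv, div_div, ← pow_succ',
      Nat.sub_add_cancel (hk _)]
    simp only [ih _ _ (fun j => hx j.castSucc) fun j => hk j.castSucc]
    rw [neg_div, Finset.sum_div, mul_neg, Finset.mul_sum, ← Finset.sum_neg_distrib]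
    refine Finset.sum_congr rfl fun i _ => ?_
    rw [pow_succ]
    ring

/-- The sum of the two largest entries is the degree in the Cauchy product, so this truncation,
unlike separate ones, respects shuffles. -/
theorem liProdTrunc_eq {a b : ℕ} (M : ℕ) (x : Fin a → ℂ) (k : Fin a → ℕ) (y : Fin b → ℂ)
    (l : Fin b → ℕ) (hx : ∀ j, x j ≠ 0) (hk : ∀ j, 1 ≤ k j) (hy : ∀ j, y j ≠ 0)
    (hl : ∀ j, 1 ≤ l j) :
    liProdTrunc M x k y l = (-1) ^ a * (-1) ^ b * ∑ n ∈ Finset.range M,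
      PowerSeries.coeff n (liSeries (revWord x k) * liSeries (revWord y l)) := by
  have hmaps : ∀ p ∈ (incTuples a M ×ˢ incTuples b M).filter (fun p => top p.1 + top p.2 < M),
      top p.1 + top p.2 ∈ Finset.range M :=
    fun p hp => Finset.mem_range.2 (Finset.mem_filter.1 hp).2
  rw [liProdTrunc, ← Finset.sum_fiberwise_of_maps_to hmaps, Finset.mul_sum]
  refine Finset.sum_congr rfl fun n hn => ?_
  have hn := Finset.mem_range.1 hn
  have hM : 0 < M := by omega
  have hmaps' : ∀ p ∈ ((incTuples a M ×ˢ incTuples b M).filter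
      (fun p => top p.1 + top p.2 < M)).filter (fun p => top p.1 + top p.2 = n),
      (top p.1, top p.2) ∈ Finset.HasAntidiagonal.antidiagonal n :=
    fun p hp => Finset.HasAntidiagonal.mem_antidiagonal.2 (Finset.mem_filter.1 hp).2
  rw [← Finset.sum_fiberwise_of_maps_to hmaps', PowerSeries.coeff_mul, Finset.mul_sum]
  refine Finset.sum_congr rfl fun q hq => ?_
  have hq := Finset.HasAntidiagonal.mem_antidiagonal.1 hq
  have hset : (((((incTuples a M ×ˢ incTuples b M).filter (fun p => top p.1 + top p.2 < M)).filter
      (fun p => top p.1 + top p.2 = n)).filter fun p => (top p.1, top p.2) = q)) =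
      incTuplesTop a q.1 ×ˢ incTuplesTop b q.2 := by
    ext p
    simp only [Finset.mem_filter, Finset.mem_product, mem_incTuples hM, mem_incTuplesTop,
      Prod.ext_iff]
    constructor
    · rintro ⟨⟨⟨⟨⟨h1, -⟩, ⟨h2, -⟩⟩, -⟩, -⟩, h3, h4⟩
      exact ⟨⟨h1, h3⟩, h2, h4⟩
    · rintro ⟨⟨h1, h3⟩, h2, h4⟩
      exact ⟨⟨⟨⟨⟨h1, by omega⟩, ⟨h2, by omega⟩⟩, by omega⟩, by omega⟩, h3, h4⟩
  rw [hset, Finset.sum_product, ← Finset.sum_mul_sum, sum_incTuplesTop x k hx hk,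
    sum_incTuplesTop y l hy hl]
  simp only [liSeries, PowerSeries.coeff_mk]
  ring


/-! ### Words and multiple `L`-values -/

theorem Lsh_eq {s : ℕ} (x : Fin s → ℂ) (k : Fin s → ℕ) :
    Lsh x k = (-1) ^ s * regIntRev (revWord x k) := by
  rw [Lsh, regIntRev, revWord, List.reverse_reverse]

theorem Admissible.replicate_append {N j : ℕ} {a : ℂ} {w : List ℂ} (h : Admissible N (a :: w)) :
    Admissible N (List.replicate j 0 ++ a :: w) := by
  induction j with
  | zero => exact h
  | succ j ih => exact ⟨Or.inl rfl, fun h => by simp at h, ih⟩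

theorem ne_zero_of_pow_eq_one {N : ℕ} (hN : N ≠ 0) {a : ℂ} (h : a ^ N = 1) : a ≠ 0 := by
  rintro rfl
  simp [hN] at h

theorem admissible_revWord {N : ℕ} (hN : N ≠ 0) {s : ℕ} (x : Fin s → ℂ) (k : Fin s → ℕ)
    (hx : ∀ j, x j ^ N = 1) : Admissible N (revWord x k) := by
  induction s with
  | zero => rw [revWord_zero]; trivial
  | succ s ih =>
    rw [revWord_succ]
    refine Admissible.replicate_append ⟨Or.inr ?_, fun _ => ?_, ih _ _ fun j => hx j.castSucc⟩
    · rw [inv_pow, hx, inv_one]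
    · exact inv_ne_zero (ne_zero_of_pow_eq_one hN (hx _))

/-- A leading 0 raises the last exponent by one; a leading root of unity opens a new entry with
exponent 1. -/
theorem exists_eq_revWord {N : ℕ} {w : List ℂ} (h : Admissible N w) :
    ∃ (s : ℕ) (ξ : Fin s → ℂ) (l : Fin s → ℕ),
      (∀ j, ξ j ^ N = 1) ∧ (∀ j, 1 ≤ l j) ∧ w = revWord ξ l := by
  induction w with
  | nil => exact ⟨0, Fin.elim0, Fin.elim0, fun j => j.elim0, fun j => j.elim0,
      (revWord_zero _ _).symm⟩
  | cons a w ih =>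
    obtain ⟨s, ξ, l, hξ, hl, hw⟩ := ih h.2.2
    by_cases ha : a = 0
    · cases s with
      | zero => exact absurd ha (h.2.1 (by rw [hw, revWord_zero]))
      | succ s =>
        refine ⟨s + 1, ξ, Fin.snoc (fun j : Fin s => l j.castSucc) (l (Fin.last s) + 1), hξ,
          fun j => ?_, ?_⟩
        · induction j using Fin.lastCases with
          | last => simp
          | cast j => simpa using hl j.castSucc
        · have h1 : l (Fin.last s) + 1 - 1 = (l (Fin.last s) - 1) + 1 := by
            have := hl (Fin.last s)
            omega
          rw [hw, revWord_succ, revWord_succ, ha]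
          simp only [Fin.snoc_last, Fin.snoc_castSucc]
          rw [h1, List.replicate_succ, List.cons_append]
    · refine ⟨s + 1, Fin.snoc ξ a⁻¹, Fin.snoc l 1, fun j => ?_, fun j => ?_, ?_⟩
      · induction j using Fin.lastCases with
        | last => simp [h.1.resolve_left ha]
        | cast j => simpa using hξ j
      · induction j using Fin.lastCases with
        | last => simp
        | cast j => simpa using hl j
      · rw [revWord_succ]
        simp [hw]

theorem neg_one_pow_mul_mem {K : Subfield ℂ} {S : Submodule K ℂ} {c : ℂ} (s : ℕ) (hc : c ∈ S) :
    (-1) ^ s * c ∈ S := by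
  rcases neg_one_pow_eq_or ℂ s with h | h <;> rw [h] <;> simpa using hc

theorem regIntRev_mem_LSpace (K : Subfield ℂ) {N : ℕ} {w : List ℂ} (h : Admissible N w) :
    regIntRev w ∈ LSpace K N := by
  obtain ⟨s, ξ, l, hξ, hl, rfl⟩ := exists_eq_revWord h
  have : regIntRev (revWord ξ l) = (-1) ^ s * Lsh ξ l := by
    rw [Lsh_eq, ← mul_assoc, ← mul_pow]
    simp
  rw [this]
  exact neg_one_pow_mul_mem s (Submodule.subset_span ⟨s, ξ, l, hξ, hl, rfl⟩)

theorem Lsh_mul_Lsh_mem_LSpace (K : Subfield ℂ) {N : ℕ} (hN : N ≠ 0) {a b : ℕ} {x : Fin a → ℂ}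
    (k : Fin a → ℕ) {y : Fin b → ℂ} (l : Fin b → ℕ) (hx : ∀ j, x j ^ N = 1)
    (hy : ∀ j, y j ^ N = 1) : Lsh x k * Lsh y l ∈ LSpace K N := by
  have hu := admissible_revWord hN x k hx
  have hv := admissible_revWord hN y l hy
  rw [Lsh_eq, Lsh_eq, mul_mul_mul_comm, ← pow_add, regIntRev_mul hN hu hv]
  refine neg_one_pow_mul_mem _ (list_sum_mem fun c hc => ?_)
  obtain ⟨w, hw, rfl⟩ := List.mem_map.1 hc
  exact regIntRev_mem_LSpace K (hu.of_mem_shuffles hv hw)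

/-! ### The error of the partial sums -/

/-- The difference of the `M`-th partial sum of the Taylor series at `1` and the regularized
value. -/
def truncError (M : ℕ) (w : List ℂ) : ℂ :=
  ∑ n ∈ Finset.range M, liCoeff w n - regIntRev w

/-- `truncError`, set to `0` for words ending in the letter `1`. -/
def convError (M : ℕ) (w : List ℂ) : ℂ := if w.head? = some 1 then 0 else truncError M w

theorem truncError_eq (M : ℕ) (w : List ℂ) :
    truncError M w = onHead 1 (fun w => truncError M (1 :: w)) w + convError M w := by
  cases w with
  | nil => simp [onHead, convError]
  | cons a w =>
    by_cases ha : a = 1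
    · simp [onHead, convError, ha]
    · simp [onHead, convError, ha]

theorem tendsto_convError {N : ℕ} (hN : N ≠ 0) {w : List ℂ} (h : Admissible N w) :
    Tendsto (fun M => convError M w) atTop (𝓝 0) := by
  by_cases h1 : w.head? = some 1
  · simp [convError, h1]
  · simpa [convError, h1, truncError] using (tendsto_sum_liCoeff hN h h1).sub_const (regIntRev w)

theorem tendsto_shuffleSum_convError {N : ℕ} (hN : N ≠ 0) {u v : List ℂ} (hu : Admissible N u)
    (hv : Admissible N v) :
    Tendsto (fun M => shuffleSum (convError M) u v) atTop (𝓝 0) := by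
  have := tendsto_list_sum (f := fun w M => convError M w) (a := fun _ => 0) (shuffles u v)
    fun w hw => tendsto_convError hN (hu.of_mem_shuffles hv hw)
  simpa [shuffleSum] using this

theorem liProdTrunc_sub {N : ℕ} (hN : N ≠ 0) {a b : ℕ} (M : ℕ) {x : Fin a → ℂ} {k : Fin a → ℕ}
    {y : Fin b → ℂ} {l : Fin b → ℕ} (hx : ∀ j, x j ^ N = 1) (hk : ∀ j, 1 ≤ k j)
    (hy : ∀ j, y j ^ N = 1) (hl : ∀ j, 1 ≤ l j) :
    liProdTrunc M x k y l - Lsh x k * Lsh y l =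
      (-1) ^ (a + b) * shuffleSum (truncError M) (revWord x k) (revWord y l) := by
  have hu := admissible_revWord hN x k hx
  have hv := admissible_revWord hN y l hy
  have hsum : ∑ n ∈ Finset.range M, PowerSeries.coeff n (shuffleSum liSeries (revWord x k)
      (revWord y l)) = shuffleSum (fun w => ∑ n ∈ Finset.range M, liCoeff w n) (revWord x k)
      (revWord y l) := by
    have := map_shuffleSum (∑ n ∈ Finset.range M,
      (PowerSeries.coeff (R := ℂ) n).toAddMonoidHom) liSeries (revWord x k) (revWord y l)
    simpa [liSeries] using this
  have hadd := shuffleSum_add (truncError M) regIntRev (revWord x k) (revWord y l)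
  simp only [truncError, sub_add_cancel] at hadd
  rw [liProdTrunc_eq M x k y l (fun j => ne_zero_of_pow_eq_one hN (hx j)) hk
    (fun j => ne_zero_of_pow_eq_one hN (hy j)) hl, Lsh_eq, Lsh_eq, mul_mul_mul_comm,
    regIntRev_mul hN hu hv, liSeries_mul hu hv, hsum, hadd, pow_add]
  ring

/-! ### Sums over the words of the second factor -/

/-- The sum of the values of `F` at the words of the coefficient of `t ^ d` of the second factor,
with its binomial weights. -/
def rightSum {s : ℕ} (y : Fin s → ℂ) (l : Fin s → ℕ) (d : ℕ) (F : List ℂ → ℂ) : ℂ :=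
  ∑ f ∈ Finset.piAntidiag (Finset.univ : Finset (Fin s)) d,
    ((∏ j, (l j + f j - 1).choose (f j) : ℕ) : ℂ) * F (revWord y (l + f))

theorem rightSum_add {s : ℕ} (y : Fin s → ℂ) (l : Fin s → ℕ) (d : ℕ) (F G : List ℂ → ℂ) :
    rightSum y l d (fun w => F w + G w) = rightSum y l d F + rightSum y l d G := by
  simp [rightSum, mul_add, Finset.sum_add_distrib]

theorem onHead_revWord {s : ℕ} (x : Fin (s + 1) → ℂ) (k : Fin (s + 1) → ℕ)
    (hk : 1 ≤ k (Fin.last s)) (F : List ℂ → ℂ) :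
    onHead 1 F (revWord x k) = if x (Fin.last s) = 1 ∧ k (Fin.last s) = 1 then
      F (revWord (fun j => x j.castSucc) fun j => k j.castSucc) else 0 := by
  rw [revWord_succ]
  by_cases h1 : k (Fin.last s) = 1
  · simp [h1, onHead]
  · obtain ⟨m, hm⟩ : ∃ m, k (Fin.last s) - 1 = m + 1 := ⟨k (Fin.last s) - 2, by omega⟩
    rw [hm, List.replicate_succ, List.cons_append, onHead, if_neg zero_ne_one, if_neg]
    exact fun h => h1 h.2

/-- Head 1 forces the last exponent l + f to be 1, so l = 1 and f = 0. Its binomial weight is then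
1, and the total degree d stays on the remaining entries. -/
theorem rightSum_onHead_succ {s : ℕ} (y : Fin (s + 1) → ℂ) (l : Fin (s + 1) → ℕ)
    (hl : ∀ j, 1 ≤ l j) (d : ℕ) (F : List ℂ → ℂ) :
    rightSum y l d (onHead 1 F) = if y (Fin.last s) = 1 ∧ l (Fin.last s) = 1 then
      rightSum (fun j => y j.castSucc) (fun j => l j.castSucc) d F else 0 := by
  have hl' : ∀ f : Fin (s + 1) → ℕ, 1 ≤ (l + f) (Fin.last s) := fun f =>
    (hl _).trans (Nat.le_add_right _ _)
  simp only [rightSum, onHead_revWord y _ (hl' _)]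
  split_ifs with h
  · rw [← Finset.sum_filter_add_sum_filter_not _ fun f : Fin (s + 1) → ℕ => f (Fin.last s) = 0]
    rw [Finset.sum_eq_zero (s := Finset.filter (fun f : Fin (s + 1) → ℕ => ¬f (Fin.last s) = 0) _),
      add_zero]
    · refine Finset.sum_bij' (fun f _ j => f j.castSucc) (fun f _ => Fin.snoc f 0) ?_ ?_ ?_ ?_ ?_
      · intro f hf
        simp only [Finset.mem_filter, Finset.mem_piAntidiag, Fin.sum_univ_castSucc] at hf
        simp only [Finset.mem_piAntidiag, Finset.mem_univ, implies_true, and_true]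
        omega
      · intro f hf
        simp only [Finset.mem_piAntidiag, Finset.mem_univ, implies_true, and_true] at hf
        simp [Finset.mem_filter, Finset.mem_piAntidiag, Fin.sum_univ_castSucc, hf]
      · intro f hf
        rw [← (Finset.mem_filter.1 hf).2]
        exact Fin.snoc_init_self f
      · intro f hf
        ext j
        simp
      · intro f hf
        have h0 := (Finset.mem_filter.1 hf).2
        rw [if_pos ⟨h.1, by simp [h.2, h0]⟩, Fin.prod_univ_castSucc]
        simp only [h0, Nat.choose_zero_right, mul_one]
        rfl
    · intro f hf
      have h0 := (Finset.mem_filter.1 hf).2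
      rw [if_neg, mul_zero]
      rintro ⟨-, h1⟩
      rw [Pi.add_apply, h.2] at h1
      omega
  · refine Finset.sum_eq_zero fun f _ => ?_
    rw [if_neg, mul_zero]
    rintro ⟨h1, h2⟩
    have := hl (Fin.last s)
    rw [Pi.add_apply] at h2
    exact h ⟨h1, by omega⟩

/-- Needed because the length r - i is a successor only up to a propositional equality. -/
theorem rightSum_onHead {s s' : ℕ} (h : s = s' + 1) (y : Fin s → ℂ) (l : Fin s → ℕ)
    (hl : ∀ j, 1 ≤ l j) (d : ℕ) (F : List ℂ → ℂ) :
    rightSum y l d (onHead 1 F) = if y ⟨s', by omega⟩ = 1 ∧ l ⟨s', by omega⟩ = 1 then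
      rightSum (fun j : Fin s' => y ⟨j, by omega⟩) (fun j : Fin s' => l ⟨j, by omega⟩) d F
      else 0 := by
  subst h
  exact rightSum_onHead_succ y l hl d F

theorem revWord_eq_nil {s : ℕ} (h : s = 0) (x : Fin s → ℂ) (k : Fin s → ℕ) :
    revWord x k = [] := by
  subst h
  exact revWord_zero x k

theorem rightSum_onHead_of_eq_zero {s : ℕ} (h : s = 0) (y : Fin s → ℂ) (l : Fin s → ℕ) (d : ℕ)
    (F : List ℂ → ℂ) : rightSum y l d (onHead 1 F) = 0 := by
  refine Finset.sum_eq_zero fun f _ => ?_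
  rw [revWord_eq_nil h, onHead, mul_zero]

theorem sum_eq_sum_add_last {s s' : ℕ} (h : s = s' + 1) (l : Fin s → ℕ) :
    ∑ j, l j = ∑ j : Fin s', l ⟨j, by omega⟩ + l ⟨s', by omega⟩ := by
  subst h
  exact Fin.sum_univ_castSucc l

/-! ### Cancellation of the divergent parts -/

/-- The coefficient of the `i`-th summand of the symmetric construction. -/
def symCoeff {r : ℕ} (a : ℕ) (x : Fin r → ℂ) (k : Fin r → ℕ) (i : Fin (r + 1)) : ℂ :=
  (-1) ^ (∑ j, rightIdx k i j) * extend x i ^ a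

theorem extend_val {r : ℕ} (x : Fin r → ℂ) (i : Fin r) : extend x i = x i := by
  simp [extend]

theorem extend_pow_eq_one {N r : ℕ} {x : Fin r → ℂ} (hx : ∀ j, x j ^ N = 1) (j : ℕ) :
    extend x j ^ N = 1 := by
  unfold extend
  split_ifs
  · exact hx _
  · exact one_pow N

theorem leftArg_pow_eq_one {N r : ℕ} {x : Fin r → ℂ} (hx : ∀ j, x j ^ N = 1) (i : Fin (r + 1))
    (j : Fin i.val) : leftArg x i j ^ N = 1 := by
  rw [leftArg, div_pow, hx, extend_pow_eq_one hx, div_one]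

theorem rightArg_pow_eq_one {N r : ℕ} {x : Fin r → ℂ} (hx : ∀ j, x j ^ N = 1) (i : Fin (r + 1))
    (j : Fin (r - i.val)) : rightArg x i j ^ N = 1 := by
  rw [rightArg, div_pow, extend_pow_eq_one hx, extend_pow_eq_one hx, div_one]

/-- The derivation rule splits each summand into a left and a right deletion, and these telescope
between neighbouring summands. The cancellation is one of words, hence valid for arbitrary ψ. -/
theorem sum_symCoeff_onHead {r : ℕ} (a : ℕ) (x : Fin r → ℂ) (k : Fin r → ℕ)
    (hx : ∀ j, x j ≠ 0) (hk : ∀ j, 1 ≤ k j) (d : ℕ) (ψ : List ℂ → ℂ) :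
    ∑ i : Fin (r + 1), symCoeff a x k i * rightSum (rightArg x i) (rightIdx k i) d
      (fun v => shuffleSum (onHead 1 ψ) (revWord (leftArg x i) (leftIdx k i)) v) = 0 := by
  simp only [shuffleSum_onHead, rightSum_add, mul_add, Finset.sum_add_distrib]
  -- The left deletion vanishes at i = 0 and the right one at i = r, where the word is empty; the
  -- rest pairs `i.succ` with `i.castSucc`.
  rw [Fin.sum_univ_succ, Fin.sum_univ_castSucc (n := r) (f := fun i => symCoeff a x k i *
    rightSum (rightArg x i) (rightIdx k i) d (onHead 1 _))]
  rw [rightSum_onHead_of_eq_zero (by simp), mul_zero, add_zero]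
  rw [revWord_eq_nil (s := (0 : Fin (r + 1)).val) rfl]
  have hnil : ∀ F : List ℂ → ℂ, onHead 1 F [] = 0 := fun _ => rfl
  simp only [hnil]
  rw [show rightSum (rightArg x 0) (rightIdx k 0) d (fun _ => (0 : ℂ)) = 0 by simp [rightSum],
    mul_zero, zero_add, ← Finset.sum_add_distrib]
  refine Finset.sum_eq_zero fun i _ => ?_
  have hs : r - i.castSucc.val = (r - i.succ.val) + 1 := by
    have := i.isLt
    simp only [Fin.val_castSucc, Fin.val_succ]
    omega
  have hleft : ∀ F : List ℂ → ℂ, onHead 1 F (revWord (leftArg x i.succ) (leftIdx k i.succ)) =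
      if x i = extend x (i + 1) ∧ k i = 1 then
        F (revWord (fun j : Fin i.val => leftArg x i.succ j.castSucc) (leftIdx k i.castSucc))
      else 0 := by
    intro F
    have he : extend x (i + 1) ≠ 0 := by
      unfold extend
      split_ifs
      · exact hx _
      · exact one_ne_zero
    refine (onHead_revWord (s := i.val) (leftArg x i.succ) (leftIdx k i.succ) (hk _) F).trans ?_
    refine if_congr (and_congr ?_ Iff.rfl) rfl rfl
    exact div_eq_one_iff_eq he
  have hidx : rightIdx k i.castSucc ⟨r - i.succ.val, by omega⟩ = k i := by
    unfold rightIdx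
    congr 1
    ext
    simp only [Fin.val_succ]
    omega
  have harg : rightArg x i.castSucc ⟨r - i.succ.val, by omega⟩ = 1 ↔ x i = extend x (i + 1) := by
    unfold rightArg
    simp only [Fin.val_succ, Fin.val_castSucc]
    rw [extend_val, div_eq_one_iff_eq (hx i), eq_comm,
      show r - (r - (i.val + 1)) = i.val + 1 by omega]
  simp only [hleft]
  rw [rightSum_onHead hs (rightArg x i.castSucc) (rightIdx k i.castSucc) (fun j => hk _), hidx]
  simp only [harg]
  split_ifs with h
  · have hex : extend x i.succ.val = extend x i.castSucc.val := by
      rw [Fin.val_succ, Fin.val_castSucc, ← h.1, extend_val]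
    -- The sign exponents differ by `k i` = 1, while the α-powers agree because the two neighbouring
    -- roots coincide.
    have hcoeff : symCoeff a x k i.castSucc = -symCoeff a x k i.succ := by
      rw [symCoeff, symCoeff, hex, sum_eq_sum_add_last hs, hidx, h.2, pow_succ]
      simp only [mul_neg, mul_one, neg_mul]
      rfl
    have hL : (fun j : Fin i.val => leftArg x i.succ j.castSucc) = leftArg x i.castSucc := by
      funext j
      unfold leftArg
      rw [hex]
      rfl
    have hR : (fun j : Fin (r - i.succ.val) => rightArg x i.castSucc ⟨j, by omega⟩) =
        rightArg x i.succ := by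
      funext j
      unfold rightArg
      rw [hex]
    rw [hcoeff, hL, hR, neg_mul]
    exact add_neg_cancel _
  · simp [rightSum]

/-- Once the head-1 parts have cancelled, only errors of convergent words remain. The two depths add
up to r, whence the common sign. -/
theorem polylogTrunc_sub_LSymSh {N r : ℕ} (hN : N ≠ 0) (a : ℕ) {x : Fin r → ℂ} {k : Fin r → ℕ}
    (hx : ∀ j, x j ^ N = 1) (hk : ∀ j, 1 ≤ k j) (d M : ℕ) :
    PowerSeries.coeff d (polylogTrunc a x k M) - PowerSeries.coeff d (LSymSh a x k) =
      (-1) ^ r * ∑ i : Fin (r + 1), symCoeff a x k i * rightSum (rightArg x i) (rightIdx k i) d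
        (fun v => shuffleSum (convError M) (revWord (leftArg x i) (leftIdx k i)) v) := by
  have hcancel := sum_symCoeff_onHead a x k (fun j => ne_zero_of_pow_eq_one hN (hx j)) hk d
    fun w => truncError M (1 :: w)
  have hsplit : ∀ u v, shuffleSum (truncError M) u v =
      shuffleSum (onHead 1 fun w => truncError M (1 :: w)) u v +
        shuffleSum (convError M) u v := by
    intro u v
    rw [← shuffleSum_add]
    exact shuffleSum_congr (E := ℂ) fun w _ => truncError_eq M w
  calc _ = (-1) ^ r * ∑ i : Fin (r + 1), symCoeff a x k i *
        rightSum (rightArg x i) (rightIdx k i) d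
          (fun v => shuffleSum (truncError M) (revWord (leftArg x i) (leftIdx k i)) v) := by
        simp only [polylogTrunc, LSymSh, PowerSeries.coeff_mk]
        rw [← Finset.sum_sub_distrib, Finset.mul_sum]
        refine Finset.sum_congr rfl fun i _ => ?_
        rw [← mul_sub, mul_left_comm, ← symCoeff, Finset.mul_sum, ← Finset.sum_sub_distrib,
          rightSum]
        congr 1
        rw [Finset.mul_sum]
        refine Finset.sum_congr rfl fun f _ => ?_
        rw [mul_left_comm (Lsh _ _), ← mul_sub, liProdTrunc_sub hN M (k := leftIdx k i)
          (l := rightIdx k i + f) (leftArg_pow_eq_one hx i) (fun j => hk _)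
          (rightArg_pow_eq_one hx i) (fun j => (hk _).trans (Nat.le_add_right _ _)), mul_left_comm,
          Nat.add_sub_of_le (Nat.lt_succ_iff.1 i.isLt)]
    _ = _ := by
        simp only [hsplit, rightSum_add, mul_add, Finset.sum_add_distrib, hcancel]
        rw [mul_zero, zero_add]

theorem tendsto_polylogTrunc {N r : ℕ} (hN : N ≠ 0) (a : ℕ) {x : Fin r → ℂ} {k : Fin r → ℕ}
    (hx : ∀ j, x j ^ N = 1) (hk : ∀ j, 1 ≤ k j) (d : ℕ) :
    Tendsto (fun M => PowerSeries.coeff d (polylogTrunc a x k M)) atTop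
      (𝓝 (PowerSeries.coeff d (LSymSh a x k))) := by
  rw [← tendsto_sub_nhds_zero_iff]
  simp only [polylogTrunc_sub_LSymSh hN a hx hk d]
  rw [← mul_zero ((-1 : ℂ) ^ r)]
  refine Tendsto.const_mul _ ?_
  rw [← Finset.sum_const_zero (s := (Finset.univ : Finset (Fin (r + 1))))]
  refine tendsto_finsetSum _ fun i _ => ?_
  rw [← mul_zero (symCoeff a x k i)]
  refine Tendsto.const_mul _ ?_
  unfold rightSum
  rw [← Finset.sum_const_zero (s := Finset.piAntidiag (Finset.univ : Finset (Fin (r - i.val))) d)]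
  refine tendsto_finsetSum _ fun f _ => ?_
  simpa using (tendsto_shuffleSum_convError hN
    (admissible_revWord hN _ (leftIdx k i) (leftArg_pow_eq_one hx i))
    (admissible_revWord hN _ (rightIdx k i + f) (rightArg_pow_eq_one hx i))).const_mul _

/-- Ratios of roots occur only inside L-values, so besides signs and integers K must contain only
the powers η^α. -/
theorem coeff_LSymSh_mem_LSpace {N r : ℕ} (hN : N ≠ 0) (a : ℕ) {x : Fin r → ℂ} (k : Fin r → ℕ)
    (hx : ∀ j, x j ^ N = 1) (K : Subfield ℂ) (hK : ∀ j, x j ^ a ∈ K) (d : ℕ) :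
    PowerSeries.coeff d (LSymSh a x k) ∈ LSpace K N := by
  have hsmul : ∀ c ∈ K, ∀ v ∈ LSpace K N, c * v ∈ LSpace K N := fun c hc v hv =>
    (LSpace K N).smul_mem (⟨c, hc⟩ : K) hv
  rw [LSymSh, PowerSeries.coeff_mk]
  refine sum_mem fun i _ => hsmul _ (mul_mem (pow_mem (neg_mem (one_mem K)) _) ?_) _ ?_
  · unfold extend
    split_ifs
    · exact hK _
    · rw [one_pow]
      exact one_mem K
  · rw [Finset.mul_sum]
    refine sum_mem fun f _ => ?_
    rw [mul_left_comm]
    exact hsmul _ (natCast_mem K _) _ (Lsh_mul_Lsh_mem_LSpace K hN _ _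
      (leftArg_pow_eq_one hx i) (rightArg_pow_eq_one hx i))

end TAdicSymmetric

end

theorem mainTheorem12 (N : ℕ) (hN : 1 ≤ N) (α : ZMod N) (r : ℕ)
    (η : Fin r → ℂ) (hη : ∀ j, η j ^ N = 1) (k : Fin r → ℕ) (hk : ∀ j, 1 ≤ k j) :
    ∃ S : PowerSeries ℂ,
      (∀ d : ℕ, Tendsto
        (fun M : ℕ => PowerSeries.coeff d (TAdicSymmetric.polylogTrunc α.val η k M))
        atTop (𝓝 (PowerSeries.coeff d S))) ∧
      S = TAdicSymmetric.LSymSh α.val η k ∧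
      ∀ K : Subfield ℂ, (∀ j, η j ^ α.val ∈ K) → ∀ d : ℕ,
        PowerSeries.coeff d S ∈ TAdicSymmetric.LSpace K N ∧
        (TAdicSymmetric.piSqLSpace K N).mkQ (PowerSeries.coeff d S) =
          TAdicSymmetric.LSym K N α η k d := by
  have hN' : N ≠ 0 := by omega
  exact ⟨TAdicSymmetric.LSymSh α.val η k,
    fun d => TAdicSymmetric.tendsto_polylogTrunc hN' α.val hη hk d, rfl,
    fun K hK d => ⟨TAdicSymmetric.coeff_LSymSh_mem_LSpace hN' α.val k hη K hK d, rfl⟩⟩
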